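/- Let $m>0$, $r>0$, let $\psi\in C_c^\infty(\mathbb R,\mathbb R)$ with $\int\psi\,d\mathbf x=1$, and let $I=[a,b]\subset\mathbb R$ be a compact interval. Let $L(I)=\mathcal D(I,\mathbb C)\oplus\mathcal D(I,\mathbb C)$, where $\mathcal D(I,\mathbb C)$ is the space of smooth functions $\mathbb R\to\mathbb C$ with support in $I$. Write $\hat h(\mathbf k)=(2\pi)^{-1/2}\int e^{-i\mathbf k\mathbf x}h(\mathbf x)\,d\mathbf x$, $\omega(\mathbf k)=\sqrt{\mathbf k^2+m^2}$, $P_\psi h=h-\psi\int h\,d\mathbf x$ and $\gamma(f,g)=\int(\overline{f_1}g_2-\overline{f_2}g_1)\,d\mathbf x$. The 2-point functions of the time-zero fields in the vacuum state of mass $m$ and in the Schubert state of the massless field (with parameters $\psi$, $r$) are, for $f=(f_1,f_2)$ and $g=(g_1,g_2)$ in $L(I)$, $$\langle f,g\rangle_m=\tfrac12\int\big(\omega^{-1}\overline{\hat f_1}\hat g_1+\omega\,\overline{\hat f_2}\hat g_2\big)\,d\mathbf k+\tfrac i2\gamma(f,g),$$ $$\langle f,g\rangle_s=\tfrac12\int\Big(|\mathbf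 k|^{-\frac12}\overline{\widehat{P_\psi f_1}}-i|\mathbf k|^{\frac12}\overline{\hat f_2}\Big)\Big(|\mathbf k|^{-\frac12}\widehat{P_\psi g_1}+i|\mathbf k|^{\frac12}\hat g_2\Big)d\mathbf k+\tfrac12\int\big(r\overline{f_1}-\tfrac ir\psi\overline{f_2}\big)d\mathbf x\int\big(rg_1+\tfrac ir\psi g_2\big)d\mathbf x .$$ Let $\mathcal H(I)$ be the Hilbert space completion of $L(I)$ with respect to the symmetrized massive scalar product $\langle f,g\rangle_{m,sym}=\tfrac12\big(\langle f,g\rangle_m+\langle\bar g,\bar f\rangle_m\big)$. Then there are unique bounded operators $C_m$ and $C_s$ on $\mathcal H(I)$ such that $$\langle f,g\rangle_m=\langle f,C_m g\rangle_{m,sym},\qquad \langle f,g\rangle_s=\langle f,C_s g\rangle_{m,sym}\qquad\text{for all } f,g\in L(I).$$ Both are positive, and the difference $\sqrt{C_m}-\sqrt{C_s}$ of their square roots is a Hilbert–Schmidt operator. -/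

import Mathlib

open MeasureTheory Complex
open scoped ContDiff Distributions ComplexConjugate

noncomputable section

namespace TimeZeroField

/-- Unitary Fourier transform on the line,
`f^(k) = (2π)^(-1/2) ∫ e^{-ikx} f(x) dx`. -/
def ft (f : ℝ → ℂ) (k : ℝ) : ℂ :=
  ((Real.sqrt (2 * Real.pi))⁻¹ : ℝ) * ∫ x : ℝ, cexp (-(I * k * x)) * f x

/-- The frequency `ω(k) = √(k² + m²)` on the mass shell. -/
def omega (m k : ℝ) : ℝ := Real.sqrt (k ^ 2 + m ^ 2)

/-- Componentwise complex conjugation of a pair of functions. -/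
def conjPair (f : (ℝ → ℂ) × (ℝ → ℂ)) : (ℝ → ℂ) × (ℝ → ℂ) :=
  (fun x => conj (f.1 x), fun x => conj (f.2 x))

/-- `γ(f,g) = ∫ (conj f₁ g₂ - conj f₂ g₁) dx`. -/
def gammaForm (f g : (ℝ → ℂ) × (ℝ → ℂ)) : ℂ :=
  ∫ x : ℝ, (conj (f.1 x) * g.2 x - conj (f.2 x) * g.1 x)

/-- `P_ψ h = h - ψ ∫ h`. -/
def projPsi (ψ : ℝ → ℝ) (h : ℝ → ℂ) : ℝ → ℂ :=
  fun x => h x - (ψ x : ℂ) * ∫ y : ℝ, h y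

/-- The two-point function `⟨f,g⟩_m` of the vacuum of mass `m` for the time-zero fields. -/
def massiveTwoPoint (m : ℝ) (f g : (ℝ → ℂ) × (ℝ → ℂ)) : ℂ :=
  1 / 2 * (∫ k : ℝ, (((omega m k)⁻¹ : ℝ) * (conj (ft f.1 k) * ft g.1 k)
      + (omega m k : ℂ) * (conj (ft f.2 k) * ft g.2 k)))
    + I / 2 * gammaForm f g

/-- The two-point function `⟨f,g⟩_s` of the Schubert state with parameters `ψ` and `r`
of the massless field, for the time-zero fields. -/
def schubertTwoPoint (ψ : ℝ → ℝ) (r : ℝ) (f g : (ℝ → ℂ) × (ℝ → ℂ)) : ℂ :=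
  1 / 2 * (∫ k : ℝ,
      (((|k| ^ (-(1 / 2) : ℝ) : ℝ) : ℂ) * conj (ft (projPsi ψ f.1) k)
        - I * ((|k| ^ (1 / 2 : ℝ) : ℝ) : ℂ) * conj (ft f.2 k))
      * (((|k| ^ (-(1 / 2) : ℝ) : ℝ) : ℂ) * ft (projPsi ψ g.1) k
        + I * ((|k| ^ (1 / 2 : ℝ) : ℝ) : ℂ) * ft g.2 k))
    + 1 / 2 * (∫ x : ℝ, ((r : ℂ) * conj (f.1 x) - I / r * ψ x * conj (f.2 x)))
      * (∫ x : ℝ, ((r : ℂ) * g.1 x + I / r * ψ x * g.2 x))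

/-- Symmetrization `⟨f,g⟩_sym = ½ (⟨f,g⟩ + ⟨conj g, conj f⟩)` of a form. -/
def symmetrize (W : (ℝ → ℂ) × (ℝ → ℂ) → (ℝ → ℂ) × (ℝ → ℂ) → ℂ)
    (f g : (ℝ → ℂ) × (ℝ → ℂ)) : ℂ :=
  1 / 2 * (W f g + W (conjPair g) (conjPair f))

/-! ### Elementary facts needed to see that the massive symmetrized form is a scalar product -/

theorem omega_nonneg (m k : ℝ) : 0 ≤ omega m k := Real.sqrt_nonneg _

theorem le_omega (m k : ℝ) : m ≤ omega m k :=
  Real.le_sqrt_of_sq_le (by nlinarith [sq_nonneg k])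

theorem omega_neg (m k : ℝ) : omega m (-k) = omega m k := by simp [omega]

theorem continuous_omega (m : ℝ) : Continuous (omega m) := by
  unfold omega; fun_prop

theorem ft_eq_fourier (f : ℝ → ℂ) (k : ℝ) :
    ft f k = ((Real.sqrt (2 * Real.pi))⁻¹ : ℝ) *
      FourierTransform.fourier f (k / (2 * Real.pi)) := by
  rw [ft, Real.fourier_eq']
  congr 1
  refine integral_congr_ae (Filter.Eventually.of_forall fun x => ?_)
  simp only [smul_eq_mul]
  congr 2
  have hpi : (Real.pi : ℂ) ≠ 0 := by exact_mod_cast Real.pi_ne_zero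
  simp only [RCLike.inner_apply, conj_trivial]
  push_cast
  field_simp

theorem ft_conj (f : ℝ → ℂ) (k : ℝ) :
    ft (fun x => conj (f x)) k = conj (ft f (-k)) := by
  simp only [ft, map_mul, conj_ofReal]
  rw [← integral_conj]
  congr 1
  refine integral_congr_ae (Filter.Eventually.of_forall fun x => ?_)
  simp [← exp_conj]

theorem gammaForm_conj (f g : (ℝ → ℂ) × (ℝ → ℂ)) :
    gammaForm (conjPair g) (conjPair f) = - gammaForm f g := by
  simp only [gammaForm, conjPair, conj_conj]
  rw [← integral_neg]
  refine integral_congr_ae (Filter.Eventually.of_forall fun x => ?_)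
  simp only []
  ring

/-- The massive symmetrized form in closed form:
`⟨f,g⟩_{m,sym} = ½ ∫ (ω⁻¹ conj f₁^ g₁^ + ω conj f₂^ g₂^) dk`. -/
theorem symmetrize_massiveTwoPoint (m : ℝ) (f g : (ℝ → ℂ) × (ℝ → ℂ)) :
    symmetrize (massiveTwoPoint m) f g =
      1 / 2 * (∫ k : ℝ, (((omega m k)⁻¹ : ℝ) * (conj (ft f.1 k) * ft g.1 k)
        + (omega m k : ℂ) * (conj (ft f.2 k) * ft g.2 k))) := by
  have key : (∫ k : ℝ, (((omega m k)⁻¹ : ℝ) *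
        (conj (ft (conjPair g).1 k) * ft (conjPair f).1 k)
        + (omega m k : ℂ) * (conj (ft (conjPair g).2 k) * ft (conjPair f).2 k)))
      = ∫ k : ℝ, (((omega m k)⁻¹ : ℝ) * (conj (ft f.1 k) * ft g.1 k)
        + (omega m k : ℂ) * (conj (ft f.2 k) * ft g.2 k)) := by
    rw [← integral_neg_eq_self]
    refine integral_congr_ae (Filter.Eventually.of_forall fun k => ?_)
    simp only [conjPair, ft_conj, omega_neg, neg_neg, conj_conj]
    ring
  simp only [symmetrize, massiveTwoPoint, gammaForm_conj, key]
  ring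

/-- The space `𝓓(I)` of smooth complex functions on the line supported in `I = [a,b]`. -/
abbrev TestFn (a b : ℝ) : Type :=
  ContDiffMapSupportedIn ℝ ℂ ⊤ (⟨Set.Icc a b, isCompact_Icc⟩ : TopologicalSpace.Compacts ℝ)

theorem exists_schwartz {a b : ℝ} (f : TestFn a b) :
    ∃ F : SchwartzMap ℝ ℂ, ∀ k, ft f k = F k := by
  have h2 : ContDiff ℝ ∞ (f : ℝ → ℂ) := f.contDiff
  let G : SchwartzMap ℝ ℂ := f.hasCompactSupport.toSchwartzMap h2
  have hpi : (2 * Real.pi)⁻¹ ≠ 0 := by positivity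
  let e : ℝ ≃L[ℝ] ℝ := ContinuousLinearEquiv.unitsEquivAut ℝ (Units.mk0 _ hpi)
  refine ⟨(((Real.sqrt (2 * Real.pi))⁻¹ : ℝ) : ℂ) •
    SchwartzMap.compCLMOfContinuousLinearEquiv ℂ e (FourierTransform.fourier G), fun k => ?_⟩
  rw [ft_eq_fourier]
  have he : e k = k / (2 * Real.pi) := by
    simp [e, div_eq_mul_inv]
  simp only [_root_.smul_apply, SchwartzMap.compCLMOfContinuousLinearEquiv_apply,
    Function.comp_apply, smul_eq_mul, he]
  rfl

theorem integrable_weight {m : ℝ} (hm : 0 < m) (F G : SchwartzMap ℝ ℂ) :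
    Integrable (fun k : ℝ => (omega m k : ℂ) * (conj (F k) * G k)) ∧
    Integrable (fun k : ℝ => (((omega m k)⁻¹ : ℝ) : ℂ) * (conj (F k) * G k)) := by
  obtain ⟨C, hC0, hC⟩ : ∃ C : ℝ, 0 ≤ C ∧ ∀ k, ‖F k‖ ≤ C := by
    obtain ⟨C, hC⟩ := F.decay 0 0
    refine ⟨C, hC.1.le, fun k => ?_⟩
    simpa using hC.2 k
  have h0 : Integrable (fun k : ℝ => ‖G k‖) := G.integrable.norm
  have h1 : Integrable (fun k : ℝ => ‖k‖ ^ 1 * ‖G k‖) := G.integrable_pow_mul volume 1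
  have hpos : ∀ k, 0 < omega m k := fun k => hm.trans_le (le_omega m k)
  have hω : Continuous (omega m) := continuous_omega m
  have hωi : Continuous (fun k => (omega m k)⁻¹) := hω.inv₀ fun k => (hpos k).ne'
  have hFG : Continuous fun k => conj (F k) * G k :=
    (continuous_conj.comp F.continuous).mul G.continuous
  have hb : ∀ k, ‖conj (F k) * G k‖ ≤ C * ‖G k‖ := fun k => by
    rw [norm_mul, RCLike.norm_conj]
    exact mul_le_mul_of_nonneg_right (hC k) (norm_nonneg _)
  constructor
  · refine Integrable.mono' ((h1.const_mul C).add (h0.const_mul (m * C)))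
      ((continuous_ofReal.comp hω).mul hFG).aestronglyMeasurable
      (Filter.Eventually.of_forall fun k => ?_)
    have hle : omega m k ≤ |k| + m := by
      refine Real.sqrt_le_iff.2 ⟨by positivity, ?_⟩
      nlinarith [abs_nonneg k, sq_abs k, mul_nonneg (abs_nonneg k) hm.le]
    rw [norm_mul, norm_real, Real.norm_of_nonneg (omega_nonneg m k)]
    calc omega m k * ‖conj (F k) * G k‖ ≤ (|k| + m) * (C * ‖G k‖) := by
          gcongr
          exact hb k
      _ = _ := by simp only [Pi.add_apply, Real.norm_eq_abs, pow_one]; ring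
  · refine Integrable.mono' (h0.const_mul (m⁻¹ * C))
      ((continuous_ofReal.comp hωi).mul hFG).aestronglyMeasurable
      (Filter.Eventually.of_forall fun k => ?_)
    have hle : (omega m k)⁻¹ ≤ m⁻¹ := inv_anti₀ hm (le_omega m k)
    rw [norm_mul, norm_real, Real.norm_of_nonneg (inv_nonneg.2 (omega_nonneg m k)), mul_assoc]
    exact mul_le_mul hle (hb k) (norm_nonneg _) (by positivity)

theorem integrable_massive {m : ℝ} (hm : 0 < m) {a b : ℝ} (f₁ f₂ g₁ g₂ : TestFn a b) :
    Integrable fun k : ℝ => (((omega m k)⁻¹ : ℝ) : ℂ) * (conj (ft f₁ k) * ft g₁ k)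
      + (omega m k : ℂ) * (conj (ft f₂ k) * ft g₂ k) := by
  obtain ⟨F₁, hF₁⟩ := exists_schwartz f₁
  obtain ⟨F₂, hF₂⟩ := exists_schwartz f₂
  obtain ⟨G₁, hG₁⟩ := exists_schwartz g₁
  obtain ⟨G₂, hG₂⟩ := exists_schwartz g₂
  simp only [hF₁, hF₂, hG₁, hG₂]
  exact (integrable_weight hm F₁ G₁).2.add (integrable_weight hm F₂ G₂).1

theorem integrable_ft {a b : ℝ} (f : TestFn a b) (k : ℝ) :
    Integrable fun x : ℝ => cexp (-(I * k * x)) * f x := by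
  refine Continuous.integrable_of_hasCompactSupport ?_ f.hasCompactSupport.mul_left
  exact (by fun_prop : Continuous fun x : ℝ => cexp (-(I * k * x))).mul f.continuous

theorem ft_add {a b : ℝ} (f g : TestFn a b) (k : ℝ) :
    ft (f + g : TestFn a b) k = ft f k + ft g k := by
  simp only [ft]
  rw [← mul_add, ← integral_add (integrable_ft f k) (integrable_ft g k)]
  congr 2
  ext x
  rw [_root_.add_apply, mul_add]

theorem ft_smul {a b : ℝ} (c : ℂ) (f : TestFn a b) (k : ℝ) :
    ft (c • f : TestFn a b) k = c * ft f k := by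
  simp only [ft]
  rw [mul_left_comm, ← integral_const_mul c]
  refine congrArg (fun z : ℂ => ((Real.sqrt (2 * Real.pi))⁻¹ : ℝ) * z)
    (integral_congr_ae (Filter.Eventually.of_forall fun x => ?_))
  change cexp _ * (c • f : TestFn a b) x = c * (cexp _ * f x)
  rw [_root_.smul_apply, smul_eq_mul, mul_left_comm]

/-- `L(I) = 𝓓(I) ⊕ 𝓓(I)` for `I = [a,b]`, to be equipped with the massive symmetrized
scalar product for mass `m > 0`. -/
def TestPair (m : ℝ) (_hm : 0 < m) (a b : ℝ) : Type := TestFn a b × TestFn a b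

namespace TestPair

variable {m : ℝ} {hm : 0 < m} {a b : ℝ}

instance : AddCommGroup (TestPair m hm a b) := inferInstanceAs (AddCommGroup (_ × _))

instance : Module ℂ (TestPair m hm a b) := inferInstanceAs (Module ℂ (TestFn a b × TestFn a b))

/-- The pair of functions underlying an element of `L(I)`. -/
def toFun (f : TestPair m hm a b) : (ℝ → ℂ) × (ℝ → ℂ) := (f.1, f.2)

/-- The scalar product `⟨f,g⟩_{m,sym}` on `L(I)`. -/
instance : PreInnerProductSpace.Core ℂ (TestPair m hm a b) where
  inner f g := symmetrize (massiveTwoPoint m) f.toFun g.toFun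
  conj_inner_symm f g := by
    rw [symmetrize_massiveTwoPoint, symmetrize_massiveTwoPoint, map_mul, ← integral_conj]
    congr 1
    · norm_num [Complex.ext_iff]
    · refine integral_congr_ae (Filter.Eventually.of_forall fun k => ?_)
      simp only [map_add, map_mul, conj_conj, conj_ofReal]
      ring
  re_inner_nonneg f := by
    rw [symmetrize_massiveTwoPoint]
    have h : ∀ k : ℝ, (((omega m k)⁻¹ : ℝ) : ℂ) * (conj (ft f.toFun.1 k) * ft f.toFun.1 k)
        + (omega m k : ℂ) * (conj (ft f.toFun.2 k) * ft f.toFun.2 k)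
        = (((omega m k)⁻¹ * ‖ft f.toFun.1 k‖ ^ 2 + omega m k * ‖ft f.toFun.2 k‖ ^ 2 : ℝ) : ℂ) :=
      fun k => by
        rw [conj_mul', conj_mul']
        push_cast
        ring
    simp only [h]
    rw [integral_complex_ofReal]
    have h2 : (0 : ℝ) ≤ ∫ k : ℝ, ((omega m k)⁻¹ * ‖ft f.toFun.1 k‖ ^ 2
        + omega m k * ‖ft f.toFun.2 k‖ ^ 2) :=
      integral_nonneg fun k => by
        have := omega_nonneg m k
        positivity
    have h3 : (1 / 2 : ℂ) = ((1 / 2 : ℝ) : ℂ) := by norm_num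
    rw [h3]
    simpa using h2
  add_left f g h := by
    rw [symmetrize_massiveTwoPoint, symmetrize_massiveTwoPoint, symmetrize_massiveTwoPoint,
      ← mul_add]
    simp only [toFun]
    rw [← integral_add (integrable_massive hm f.1 f.2 h.1 h.2)
      (integrable_massive hm g.1 g.2 h.1 h.2)]
    congr 2
    ext k
    have e1 : ft ((f + g).1 : TestFn a b) k = ft f.1 k + ft g.1 k := ft_add f.1 g.1 k
    have e2 : ft ((f + g).2 : TestFn a b) k = ft f.2 k + ft g.2 k := ft_add f.2 g.2 k
    rw [e1, e2, map_add, map_add]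
    ring
  smul_left f g c := by
    rw [symmetrize_massiveTwoPoint, symmetrize_massiveTwoPoint, mul_left_comm]
    simp only [toFun]
    rw [← integral_const_mul (conj c)]
    refine congrArg (fun z : ℂ => 1 / 2 * z)
      (integral_congr_ae (Filter.Eventually.of_forall fun k => ?_))
    beta_reduce
    have e1 : ft ((c • f).1 : TestFn a b) k = c * ft f.1 k := ft_smul c f.1 k
    have e2 : ft ((c • f).2 : TestFn a b) k = c * ft f.2 k := ft_smul c f.2 k
    rw [e1, e2, map_mul, map_mul]
    ring

instance : SeminormedAddCommGroup (TestPair m hm a b) :=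
  InnerProductSpace.Core.toSeminormedAddCommGroup (𝕜 := ℂ)

instance : InnerProductSpace ℂ (TestPair m hm a b) :=
  InnerProductSpace.ofCore inferInstance

theorem inner_eq (f g : TestPair m hm a b) :
    inner ℂ f g = symmetrize (massiveTwoPoint m) f.toFun g.toFun := rfl

end TestPair

/-- The Hilbert space completion of `L([a,b])` with respect to `⟨·,·⟩_{m,sym}`. -/
abbrev OneParticle (m : ℝ) (hm : 0 < m) (a b : ℝ) : Type :=
  UniformSpace.Completion (TestPair m hm a b)

/-- The bounded operator `C` defines the form `W` on `L(I)` in terms of `⟨·,·⟩_{m,sym}`: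
`W(f,g) = ⟨f, C g⟩_{m,sym}`. -/
def Defines {m : ℝ} {hm : 0 < m} {a b : ℝ}
    (C : OneParticle m hm a b →L[ℂ] OneParticle m hm a b)
    (W : (ℝ → ℂ) × (ℝ → ℂ) → (ℝ → ℂ) × (ℝ → ℂ) → ℂ) : Prop :=
  ∀ f g : TestPair m hm a b,
    W f.toFun g.toFun =
      inner ℂ (f : OneParticle m hm a b) (C (g : OneParticle m hm a b))

/-- `T` is a Hilbert–Schmidt operator: `∑ ‖T eᵢ‖² < ∞` for an orthonormal basis `(eᵢ)`
(equivalently, for every one). -/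
def IsHilbertSchmidt {H : Type*} [NormedAddCommGroup H] [InnerProductSpace ℂ H]
    (T : H →L[ℂ] H) : Prop :=
  ∃ (s : Set H) (e : HilbertBasis s ℂ H), Summable fun i => ‖T (e i)‖ ^ 2

end TimeZeroField

end

/-! Two facts combine: a Powers–Størmer inequality and a trace-class estimate for `Cm - Cs`.

Abstract part. Let `A, B ≥ 0` and let the diagonal sums `∑ |⟨x, (A - B) x⟩|` be bounded uniformly
over finite orthonormal families. Then `A - B` is compact, hence so is `√A - √B`, which therefore
has an orthonormal eigenbasis. On an eigenvector `e` with eigenvalue `c = ⟨e, √A e⟩ - ⟨e, √B e⟩` one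
gets `⟨e, (A - B) e⟩ = c (⟨e, √A e⟩ + ⟨e, √B e⟩)`, so `c² ≤ |⟨e, (A - B) e⟩|`, and the sum over the
basis is finite (`isHilbertSchmidt_sqrt_sub_sqrt`).

Analytic part. On the diagonal the antisymmetric parts of the two forms cancel. What remains is a
momentum integral of weighted squares of the functionals `f ↦ f̂₁(k)`, `f̂₂(k)`, `(P_ψ f₁)^(k)`, and
two rank-one terms (`massiveTwoPoint_sub_schubertTwoPoint`). Since `f` is supported in `I`,
inserting a cutoff makes these functionals bounded: `|f̂₁(k)|² ≤ C (1+|k|) ‖f‖²` and `|f̂₂(k)|² ≤ C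
(1+|k|)⁻¹ ‖f‖²`. By Bessel's inequality the same bounds, without `‖f‖²`, control the sums over an
orthonormal family. At large `|k|` the weight differences `|k|⁻¹ - ω⁻¹ = O(|k|⁻³)` and `ω - |k| =
O(|k|⁻¹)` make the density `O(|k|⁻²)`. Near `k = 0` the infrared singularity `|k|⁻¹` is harmless
because `(P_ψ f₁)^` vanishes linearly. The integral is thus bounded uniformly
(`TestPair.sum_norm_sub_le`).

The functionals are defined on `L(I)`, not on its completion, so orthonormal families are replaced
by nearby families in `L(I)` that satisfy Bessel's inequality up to a factor. Applied to a single
vector, the same estimate shows that the Schubert form is bounded, which yields `Cs`. -/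

noncomputable section

namespace TimeZeroField

/-! ### Powers–Størmer inequality on a Hilbert space -/

section Operators

variable {H : Type*} [NormedAddCommGroup H] [InnerProductSpace ℂ H]

/-- The diagonal matrix elements of `D` in finite orthonormal families are absolutely summable,
uniformly in the family. -/
def HasBoundedDiagonal (D : H →L[ℂ] H) : Prop :=
  ∃ C : ℝ, ∀ s : Finset H, Orthonormal ℂ ((↑) : s → H) →
    ∑ x ∈ s, ‖inner ℂ x (D x)‖ ≤ C

theorem orthonormal_insert [DecidableEq H] {s : Finset H} (hs : Orthonormal ℂ ((↑) : s → H))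
    {v : H} (hv : ‖v‖ = 1) (hvs : ∀ x ∈ s, inner ℂ x v = 0) :
    Orthonormal ℂ (fun x : (insert v s : Finset H) => (x : H)) := by
  refine ⟨?_, ?_⟩
  · rintro ⟨x, hx⟩
    rcases Finset.mem_insert.1 hx with rfl | hx
    · exact hv
    · exact hs.1 ⟨x, hx⟩
  · rintro ⟨x, hx⟩ ⟨y, hy⟩ hxy
    have hne : x ≠ y := fun h => hxy (Subtype.ext h)
    rcases Finset.mem_insert.1 hx with rfl | hx' <;> rcases Finset.mem_insert.1 hy with rfl | hy'
    · exact (hne rfl).elim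
    · exact inner_eq_zero_symm.1 (hvs y hy')
    · exact hvs x hx'
    · exact hs.2 (i := ⟨x, hx'⟩) (j := ⟨y, hy'⟩) fun h => hne (congrArg Subtype.val h)

/-- Choose an orthonormal family whose diagonal sum is within `ε` of the supremum. A further unit
vector orthogonal to it may be adjoined, so its own diagonal element cannot exceed `ε`. Scaling
gives the quadratic bound. -/
theorem HasBoundedDiagonal.exists_finset {D : H →L[ℂ] H} (hD : HasBoundedDiagonal D)
    {ε : ℝ} (hε : 0 < ε) :
    ∃ s : Finset H, ∀ v ∈ (Submodule.span ℂ (s : Set H))ᗮ, ‖inner ℂ v (D v)‖ ≤ ε * ‖v‖ ^ 2 := by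
  classical
  obtain ⟨C, hC⟩ := hD
  let A : Set ℝ := {t | ∃ s : Finset H, Orthonormal ℂ ((↑) : s → H) ∧
    t = ∑ x ∈ s, ‖inner ℂ x (D x)‖}
  have hA : BddAbove A := ⟨C, by rintro _ ⟨s, hs, rfl⟩; exact hC s hs⟩
  have hne : A.Nonempty := ⟨0, ∅, ⟨fun x => (Finset.notMem_empty _ x.2).elim,
    fun x => (Finset.notMem_empty _ x.2).elim⟩, by simp⟩
  obtain ⟨t, ⟨s, hs, rfl⟩, ht⟩ := exists_lt_of_lt_csSup hne (sub_lt_self (sSup A) hε)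
  refine ⟨s, fun v hv => ?_⟩
  have hunit : ∀ u ∈ (Submodule.span ℂ (s : Set H))ᗮ, ‖u‖ = 1 → ‖inner ℂ u (D u)‖ ≤ ε := by
    intro u hu hu1
    have hus : ∀ x ∈ s, inner ℂ x u = 0 := fun x hx =>
      (Submodule.mem_orthogonal _ _).1 hu x (Submodule.subset_span hx)
    have hnot : u ∉ s := fun h => by
      have := hus u h
      rw [inner_self_eq_zero] at this
      simp [this] at hu1
    have := le_csSup hA ⟨_, orthonormal_insert hs hu1 hus, rfl⟩
    rw [Finset.sum_insert hnot] at this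
    linarith
  rcases eq_or_ne v 0 with rfl | h0
  · simp
  have h1 := hunit (((‖v‖⁻¹ : ℝ) : ℂ) • v) (Submodule.smul_mem _ _ hv)
    (by rw [norm_smul, norm_real, norm_inv, norm_norm, inv_mul_cancel₀ (norm_ne_zero_iff.2 h0)])
  rw [map_smul, inner_smul_left, inner_smul_right, conj_ofReal, norm_mul, norm_mul, norm_real,
    norm_inv, norm_norm] at h1
  have hpos : 0 < ‖v‖ := norm_pos_iff.2 h0
  field_simp at h1
  linarith

theorem norm_le_of_isSymmetric {T : H →L[ℂ] H} (hT : (T : H →ₗ[ℂ] H).IsSymmetric) {ε : ℝ}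
    (h : ∀ x, ‖inner ℂ x (T x)‖ ≤ ε * ‖x‖ ^ 2) (hε : 0 ≤ ε) : ‖T‖ ≤ ε := by
  rw [ContinuousLinearMap.norm_eq_iSup_rayleighQuotient T hT]
  refine ciSup_le fun x => ?_
  rw [ContinuousLinearMap.rayleighQuotient, abs_div, abs_sq]
  refine div_le_of_le_mul₀ (by positivity) hε ?_
  rw [ContinuousLinearMap.reApplyInnerSelf_apply]
  refine (RCLike.abs_re_le_norm _).trans ?_
  rw [norm_inner_symm]
  exact h x

theorem isCompactOperator_starProjection (U : Submodule ℂ H) [FiniteDimensional ℂ U] :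
    IsCompactOperator U.starProjection := by
  have : ProperSpace U := FiniteDimensional.proper ℂ U
  exact (isCompactOperator_of_locallyCompactSpace_rng U.subtypeL).comp_clm
    (U.orthogonalProjectionOnto : H →L[ℂ] U)

/-- Modulo the ideal of compact operators `A` and `B` coincide, hence so do all polynomials in them.
-/
theorem isCompactOperator_aeval_sub {A B : H →L[ℂ] H} (h : IsCompactOperator (A - B : H →L[ℂ] H))
    (p : Polynomial ℝ) :
    IsCompactOperator (Polynomial.aeval A p - Polynomial.aeval B p : H →L[ℂ] H) := by
  have hpow : ∀ n : ℕ, IsCompactOperator (A ^ n - B ^ n : H →L[ℂ] H) := by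
    intro n
    induction n with
    | zero => 
      rw [pow_zero, pow_zero, sub_self]
      exact isCompactOperator_zero
    | succ n ih =>
      have : A ^ (n + 1) - B ^ (n + 1) = A ^ n * (A - B) + (A ^ n - B ^ n) * B := by
        rw [pow_succ, pow_succ]; noncomm_ring
      rw [this]
      have h1 : IsCompactOperator (A ^ n * (A - B) : H →L[ℂ] H) :=
        IsCompactOperator.clm_comp (f := (A - B : H →L[ℂ] H)) h (A ^ n)
      have h2 : IsCompactOperator ((A ^ n - B ^ n) * B : H →L[ℂ] H) :=
        IsCompactOperator.comp_clm (f := (A ^ n - B ^ n : H →L[ℂ] H)) ih B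
      exact h1.add h2
  induction p using Polynomial.induction_on' with
  | add p q hp hq =>
    rw [map_add, map_add, add_sub_add_comm]
    exact hp.add hq
  | monomial n c =>
    rw [Polynomial.aeval_monomial, Polynomial.aeval_monomial, ← mul_sub]
    exact IsCompactOperator.clm_comp (f := (A ^ n - B ^ n : H →L[ℂ] H)) (hpow n)
      (algebraMap ℝ (H →L[ℂ] H) c)

variable [CompleteSpace H]

/-- With `Q` the projection onto the complement of a suitable finite-dimensional space, `Q D Q` has
a small quadratic form and so, being symmetric, a small norm. The remainder `D - Q D Q = P D + Q D
P` has finite rank, so `D` is a norm limit of finite-rank operators. -/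
theorem HasBoundedDiagonal.isCompactOperator {D : H →L[ℂ] H} (hD : HasBoundedDiagonal D)
    (hsymm : (D : H →ₗ[ℂ] H).IsSymmetric) : IsCompactOperator D := by
  have hcl := isClosed_setOfPred_isCompactOperator (σ₁₂ := RingHom.id ℂ) (M₁ := H) (M₂ := H)
  refine hcl.closure_subset (Metric.mem_closure_iff.2 fun ε hε => ?_)
  obtain ⟨s, hs⟩ := hD.exists_finset (half_pos hε)
  set U := Submodule.span ℂ (s : Set H)
  have hfin : FiniteDimensional ℂ U := FiniteDimensional.span_finset ℂ s
  set P := U.starProjection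
  set Q := Uᗮ.starProjection
  have hQ : ∀ x, Q x = x - P x := fun x => by
    simp [Q, P, Submodule.starProjection_orthogonal']
  have hQs : ∀ x y, inner ℂ (Q x) y = inner ℂ x (Q y) := fun x y =>
    Submodule.inner_starProjection_left_eq_right _ x y
  refine ⟨D - Q ∘L D ∘L Q, ?_, ?_⟩
  · have hPc := isCompactOperator_starProjection U
    have h1 : IsCompactOperator (P ∘L D) := hPc.comp_clm D
    have h2 : IsCompactOperator (Q ∘L D ∘L P) := (hPc.clm_comp D).clm_comp Q
    have h3 : (D - Q ∘L D ∘L Q) = P ∘L D + Q ∘L D ∘L P := by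
      ext x
      simp only [_root_.sub_apply, _root_.add_apply, ContinuousLinearMap.comp_apply, hQ x,
        map_sub]
      rw [hQ (D x)]
      abel
    show IsCompactOperator (D - Q ∘L D ∘L Q : H →L[ℂ] H)
    rw [h3]
    exact h1.add h2
  · rw [dist_eq_norm, sub_sub_cancel]
    refine (norm_le_of_isSymmetric (fun x y => ?_) (fun x => ?_) (half_pos hε).le).trans_lt
      (half_lt_self hε)
    · change inner ℂ (Q (D (Q x))) y = inner ℂ x (Q (D (Q y)))
      rw [hQs, ← hQs x]
      exact hsymm _ _
    · change ‖inner ℂ x (Q (D (Q x)))‖ ≤ _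
      rw [← hQs]
      refine (hs _ (Submodule.starProjection_apply_mem _ x)).trans ?_
      have : ‖Q x‖ ≤ ‖x‖ := Submodule.norm_starProjection_apply_le _ x
      gcongr

/-- By Weierstrass the square root is a uniform limit of polynomials on an interval containing both
spectra, and polynomials preserve compactness of the difference. -/
theorem isCompactOperator_sqrt_sub_sqrt {A B : H →L[ℂ] H} (hA : 0 ≤ A) (hB : 0 ≤ B)
    (h : IsCompactOperator (A - B : H →L[ℂ] H)) :
    IsCompactOperator (CFC.sqrt A - CFC.sqrt B : H →L[ℂ] H) := by
  have hcl := isClosed_setOfPred_isCompactOperator (σ₁₂ := RingHom.id ℂ) (M₁ := H) (M₂ := H)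
  refine hcl.closure_subset (Metric.mem_closure_iff.2 fun ε hε => ?_)
  -- The factor `‖1‖` covers `H = 0`, where the identity has norm zero.
  set M := max (‖A‖ * ‖(1 : H →L[ℂ] H)‖) (‖B‖ * ‖(1 : H →L[ℂ] H)‖)
  obtain ⟨p, hp⟩ := exists_polynomial_near_of_continuousOn 0 M Real.sqrt
    Real.continuous_sqrt.continuousOn (ε / 3) (by positivity)
  have key : ∀ T : H →L[ℂ] H, 0 ≤ T → ‖T‖ * ‖(1 : H →L[ℂ] H)‖ ≤ M →
      ‖CFC.sqrt T - Polynomial.aeval T p‖ ≤ ε / 3 := by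
    intro T hT hTM
    have hsa : IsSelfAdjoint T := IsSelfAdjoint.of_nonneg hT
    rw [CFC.sqrt_eq_real_sqrt T hT, cfcₙ_eq_cfc, ← cfc_polynomial p T hsa,
      ← cfc_sub (a := T) Real.sqrt p.eval Real.continuous_sqrt.continuousOn
        p.continuous.continuousOn]
    refine norm_cfc_le (by positivity) fun x hx => ?_
    have h0 : 0 ≤ x := spectrum_nonneg_of_nonneg hT hx
    have h1 := spectrum.subset_closedBall_norm_mul T hx
    rw [mem_closedBall_zero_iff, Real.norm_of_nonneg h0] at h1
    rw [norm_sub_rev]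
    exact (hp x ⟨h0, h1.trans hTM⟩).le
  refine ⟨Polynomial.aeval A p - Polynomial.aeval B p, isCompactOperator_aeval_sub h p, ?_⟩
  have e : CFC.sqrt A - CFC.sqrt B - (Polynomial.aeval A p - Polynomial.aeval B p)
    = (CFC.sqrt A - Polynomial.aeval A p) - (CFC.sqrt B - Polynomial.aeval B p) := by abel
  rw [dist_eq_norm, e]
  have h1 := key A hA (le_max_left _ _)
  have h2 := key B hB (le_max_right _ _)
  have h3 := norm_sub_le (CFC.sqrt A - Polynomial.aeval A p) (CFC.sqrt B - Polynomial.aeval B p)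
  linarith

/-- A compact self-adjoint operator has a Hilbert basis of eigenvectors. -/
theorem exists_hilbertBasis_eigenvectors {X : H →L[ℂ] H} (hX : IsCompactOperator X)
    (hsymm : (X : H →ₗ[ℂ] H).IsSymmetric) :
    ∃ (s : Set H) (e : HilbertBasis s ℂ H), ∀ i, ∃ c : ℂ, X (e i) = c • e i := by
  -- All `μ` are taken, including `0`: Hilbert bases of the eigenspaces, most of them trivial, are
  -- glued into one, which is total by the spectral theorem for compact symmetric operators.
  let V : ℂ → Submodule ℂ H := fun μ => Module.End.eigenspace (X : H →ₗ[ℂ] H) μ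
  have hVcl : ∀ μ, IsClosed (V μ : Set H) := fun μ => by
    have : (V μ : Set H) = {x | X x = μ • x} := by
      ext x
      simp [V]
    rw [this]
    exact isClosed_eq X.continuous (continuous_const_smul μ)
  have hVc : ∀ μ, CompleteSpace (V μ) := fun μ => (hVcl μ).completeSpace_coe
  choose w b _ using fun μ => exists_hilbertBasis ℂ (V μ)
  have ho : Orthonormal ℂ fun a : Σ μ, w μ => (V a.1).subtypeₗᵢ (b a.1 a.2) :=
    hsymm.orthogonalFamily_eigenspaces.orthonormal_sigma_orthonormal
      (α := fun μ => w μ) (v_family := fun μ => b μ) fun μ => (b μ).orthonormal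
  have htriv : (Submodule.span ℂ (Set.range fun a : Σ μ, w μ =>
      (V a.1).subtypeₗᵢ (b a.1 a.2)))ᗮ = ⊥ := by
    rw [eq_bot_iff, ← ContinuousLinearMap.orthogonalComplement_iSup_eigenspaces_eq_bot hX hsymm,
      ← Submodule.iInf_orthogonal]
    intro x hx
    rw [Submodule.mem_iInf]
    intro μ
    have h0 : (V μ).orthogonalProjectionOnto x = 0 := by
      refine (b μ).repr.injective ?_
      ext i
      rw [HilbertBasis.repr_apply_apply, map_zero, lp.coeFn_zero, Pi.zero_apply,
        Submodule.inner_orthogonalProjectionOnto_eq_of_mem_left]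
      exact (Submodule.mem_orthogonal _ _).1 hx _ (Submodule.subset_span ⟨⟨μ, i⟩, rfl⟩)
    exact Submodule.orthogonalProjectionOnto_eq_zero_iff.1 h0
  refine ⟨_, HilbertBasis.mkOfOrthogonalEqBot ho.toSubtypeRange
    (by rwa [Subtype.range_coe]), ?_⟩
  rintro ⟨_, ⟨μ, i⟩, rfl⟩
  refine ⟨μ, ?_⟩
  rw [HilbertBasis.coe_mkOfOrthogonalEqBot]
  exact Module.End.mem_eigenspace_iff.1 (b μ i).2

/-- A form of the **Powers–Størmer inequality**. -/
theorem isHilbertSchmidt_sqrt_sub_sqrt {A B : H →L[ℂ] H} (hA : 0 ≤ A) (hB : 0 ≤ B)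
    (h : HasBoundedDiagonal (A - B)) : IsHilbertSchmidt (CFC.sqrt A - CFC.sqrt B) := by
  have symm_of_nonneg : ∀ T : H →L[ℂ] H, 0 ≤ T → ∀ x y, inner ℂ (T x) y = inner ℂ x (T y) :=
    fun T hT => ((ContinuousLinearMap.nonneg_iff_isPositive T).1 hT).isSymmetric
  have hSA := CFC.sqrt_nonneg A
  have hSB := CFC.sqrt_nonneg B
  set S := CFC.sqrt A with hS
  set T := CFC.sqrt B with hT
  have hA2 : S * S = A := CFC.sqrt_mul_sqrt_self A hA
  have hB2 : T * T = B := CFC.sqrt_mul_sqrt_self B hB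
  have hcomp : IsCompactOperator (S - T : H →L[ℂ] H) :=
    isCompactOperator_sqrt_sub_sqrt hA hB (h.isCompactOperator fun x y => by
      simp [inner_sub_left, inner_sub_right, symm_of_nonneg A hA, symm_of_nonneg B hB])
  have hsymm : ((S - T : H →L[ℂ] H) : H →ₗ[ℂ] H).IsSymmetric := fun x y => by
    simp [inner_sub_left, inner_sub_right, symm_of_nonneg S hSA, symm_of_nonneg T hSB]
  obtain ⟨s, e, he⟩ := exists_hilbertBasis_eigenvectors hcomp hsymm
  obtain ⟨C, hC⟩ := h
  -- Write `A - B = S (S - T) + (S - T) T`. On an eigenvector of `S - T` with eigenvalue `c = p -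
  -- q`, where `p, q ≥ 0` are the diagonal elements of `S` and `T`, this gives `c (p + q)`, and `|c|
  -- ≤ p + q`.
  have hle : ∀ i, ‖(S - T) (e i)‖ ^ 2 ≤ ‖inner ℂ (e i) ((A - B) (e i))‖ := by
    intro i
    obtain ⟨c, hc⟩ := he i
    have h1 : ‖e i‖ = 1 := e.orthonormal.1 i
    have hin : inner ℂ (e i) (e i) = (1 : ℂ) := by
      rw [inner_self_eq_norm_sq_to_K, h1]; simp
    have hST : S (e i) = T (e i) + c • e i := by
      rw [← hc, _root_.sub_apply]; abel
    have hp : ∀ R : H →L[ℂ] H, 0 ≤ R → ∃ t : ℝ, 0 ≤ t ∧ inner ℂ (e i) (R (e i)) = (t : ℂ) := by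
      intro R hR
      have := ((ContinuousLinearMap.nonneg_iff_isPositive R).1 hR).inner_nonneg_right (e i)
      obtain ⟨t, ht, h⟩ := RCLike.nonneg_iff_exists_ofReal.1 this
      exact ⟨t, ht, h.symm⟩
    obtain ⟨p, hp0, hpS⟩ := hp S hSA
    obtain ⟨q, hq0, hqT⟩ := hp T hSB
    have hsymm' : ∀ x y, inner ℂ ((S - T) x) y = inner ℂ x ((S - T) y) := hsymm
    have hpq : c = ((p - q : ℝ) : ℂ) := by
      have := hpS
      rw [hST, inner_add_right, inner_smul_right, hin, hqT] at this
      push_cast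
      linear_combination this
    have hAB : inner ℂ (e i) ((A - B) (e i)) = c * ((p + q : ℝ) : ℂ) := by
      have e1 : (A - B) (e i) = S ((S - T) (e i)) + (S - T) (T (e i)) := by
        rw [← hA2, ← hB2]
        simp
      rw [e1, inner_add_right, ← hsymm', hc, map_smul,
        inner_smul_right, inner_smul_left, hpS, hqT, hpq, conj_ofReal]
      push_cast
      ring
    rw [hAB, hc, norm_smul, h1, mul_one, norm_mul, hpq, norm_real, norm_real, Real.norm_eq_abs,
      Real.norm_eq_abs, sq]
    refine mul_le_mul_of_nonneg_left ?_ (abs_nonneg _)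
    rw [abs_of_nonneg (add_nonneg hp0 hq0), abs_le]
    constructor <;> linarith
  refine ⟨s, e, summable_of_sum_le (c := C) (fun i => by positivity) fun u => ?_⟩
  refine (Finset.sum_le_sum fun i _ => hle i).trans ?_
  have hinj : Function.Injective e := e.orthonormal.linearIndependent.injective
  have := hC (u.map ⟨e, hinj⟩) ?_
  · simpa using this
  · refine e.orthonormal.toSubtypeRange.comp
      (fun x : (u.map ⟨e, hinj⟩ : Finset H) => (⟨x, by
        obtain ⟨i, -, hi⟩ := Finset.mem_map.1 x.2
        exact ⟨i, hi⟩⟩ : Set.range e)) fun x y hxy => ?_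
    exact Subtype.ext (Subtype.mk.inj hxy)

end Operators

/-! ### Positive forms, their operators on the completion, and Bessel families -/

section Forms

open UniformSpace

/-- A type synonym carrying the scalar product given by a positive form. -/
def FormSpace (E : Type*) : Type _ := E

instance (E : Type*) [AddCommGroup E] : AddCommGroup (FormSpace E) :=
  inferInstanceAs (AddCommGroup E)

instance (E : Type*) [AddCommGroup E] [Module ℂ E] : Module ℂ (FormSpace E) :=
  inferInstanceAs (Module ℂ E)

variable {E : Type*} [SeminormedAddCommGroup E] [InnerProductSpace ℂ E]

/-- A positive semidefinite hermitian form on `E`. -/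
structure IsPositiveForm (W : E → E → ℂ) : Prop where
  add_right : ∀ f g h, W f (g + h) = W f g + W f h
  smul_right : ∀ (c : ℂ) f g, W f (c • g) = c * W f g
  conj_symm : ∀ f g, conj (W g f) = W f g
  re_nonneg : ∀ f, 0 ≤ (W f f).re

theorem IsPositiveForm.add_left {W : E → E → ℂ} (hW : IsPositiveForm W)
    (f g h : E) : W (f + g) h = W f h + W g h := by
  rw [← hW.conj_symm, hW.add_right, map_add, hW.conj_symm, hW.conj_symm]

theorem IsPositiveForm.smul_left {W : E → E → ℂ} (hW : IsPositiveForm W)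
    (c : ℂ) (f g : E) : W (c • f) g = conj c * W f g := by
  rw [← hW.conj_symm, hW.smul_right, map_mul, hW.conj_symm]

/-- Complete `E` a second time, with `W` as scalar product. The bound `hK` makes the identity of `E`
extend to a bounded map `A` between the completions, and `C = A* A` is positive and represents `W`.
-/
theorem exists_positive_operator {W : E → E → ℂ} (hW : IsPositiveForm W)
    {K : ℝ} (hK : ∀ f, (W f f).re ≤ K * ‖f‖ ^ 2) :
    ∃ C : Completion E →L[ℂ] Completion E, 0 ≤ C ∧
      ∀ f g : E, W f g = inner ℂ (f : Completion E) (C (g : Completion E)) := by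
  let core : PreInnerProductSpace.Core ℂ (FormSpace E) :=
    { inner := fun f g => W f g
      conj_inner_symm := fun f g => hW.conj_symm f g
      re_inner_nonneg := fun f => hW.re_nonneg f
      add_left := hW.add_left
      smul_left := fun f g c => hW.smul_left c f g }
  let : SeminormedAddCommGroup (FormSpace E) :=
    InnerProductSpace.Core.toSeminormedAddCommGroup (𝕜 := ℂ) (c := core)
  let : InnerProductSpace ℂ (FormSpace E) := InnerProductSpace.ofCore core
  have hin : ∀ f g : E, inner ℂ (show FormSpace E from f) (show FormSpace E from g) = W f g :=
    fun f g => rfl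
  let j : E →ₗ[ℂ] Completion (FormSpace E) :=
    { toFun := fun f => ((show FormSpace E from f : FormSpace E) : Completion (FormSpace E))
      map_add' := fun f g => Completion.coe_add (α := FormSpace E) f g
      map_smul' := fun c f => Completion.coe_smul (M := ℂ) (X := FormSpace E) c f }
  let e : E →ₗ[ℂ] Completion E := (Completion.toComplL (𝕜 := ℂ) (E := E)).toLinearMap
  have hd : DenseRange e := Completion.denseRange_coe
  have hj : ∀ f g : E, inner ℂ (j f) (j g) = W f g := fun f g => by
    rw [← hin]
    exact Completion.inner_coe (𝕜 := ℂ) (E := FormSpace E) f g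
  have hb : ∃ C, ∀ f, ‖j f‖ ≤ C * ‖e f‖ := by
    refine ⟨Real.sqrt (max K 0), fun f => ?_⟩
    have h1 : ‖e f‖ = ‖f‖ := Completion.norm_coe f
    have h2 : ‖j f‖ ^ 2 = (W f f).re := by
      rw [← hj, ← inner_self_eq_norm_sq (𝕜 := ℂ)]
      rfl
    rw [h1]
    refine le_of_sq_le_sq ?_ (by positivity)
    rw [h2, mul_pow, Real.sq_sqrt (le_max_right _ _)]
    refine (hK f).trans ?_
    gcongr
    exact le_max_left _ _
  let A : Completion E →L[ℂ] Completion (FormSpace E) := j.extendOfNorm e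
  have hA : ∀ f : E, A (f : Completion E) = j f := fun f =>
    LinearMap.extendOfNorm_eq hd hb f
  refine ⟨A.adjoint ∘L A, ?_, fun f g => ?_⟩
  · rw [ContinuousLinearMap.nonneg_iff_isPositive]
    exact ContinuousLinearMap.isPositive_adjoint_comp_self A
  · rw [ContinuousLinearMap.comp_apply, ContinuousLinearMap.adjoint_inner_right, hA, hA, hj]

theorem operator_eq_of_inner_coe_eq {C C' : Completion E →L[ℂ] Completion E}
    (h : ∀ f g : E, inner ℂ (f : Completion E) (C (g : Completion E))
      = inner ℂ (f : Completion E) (C' (g : Completion E))) : C = C' := by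
  ext x
  refine Completion.induction_on x (isClosed_eq C.continuous C'.continuous) fun g => ?_
  refine ext_inner_left ℂ fun v => ?_
  refine Completion.induction_on v ?_ fun f => h f g
  exact isClosed_eq (by fun_prop) (by fun_prop)

/-- A finite family in `E` satisfying Bessel's inequality up to the factor `T`. -/
def IsBesselFamily {ι : Type*} [Fintype ι] (f : ι → E) (T : ℝ) : Prop :=
  ∀ (l : E →ₗ[ℂ] ℂ) (N : ℝ), (∀ g, ‖l g‖ ≤ N * ‖g‖) → ∑ i, ‖l (f i)‖ ^ 2 ≤ T * N ^ 2

/-- Lets an estimate for Bessel families double as a bound of a quadratic form by `‖f‖²`. -/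
theorem isBesselFamily_single (f : E) : IsBesselFamily (fun _ : Unit => f) (‖f‖ ^ 2) := by
  intro l N hl
  rw [Fintype.sum_unique, ← mul_pow, mul_comm]
  gcongr
  exact hl f

/-- A bounded functional extends to the completion and is represented there by a vector, to which
Bessel's inequality for `e` applies. The displacement from `e` costs at most another `N²`, and `(x +
y)² ≤ 2x² + 2y²` turns the two contributions into the factor `4`. -/
theorem isBesselFamily_of_near {ι : Type*} [Fintype ι] {e : ι → Completion E}
    (he : Orthonormal ℂ e) {f : ι → E} (hf : ∑ i, ‖(f i : Completion E) - e i‖ ^ 2 ≤ 1) :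
    IsBesselFamily f 4 := by
  intro l N hl
  have hd : DenseRange (Completion.toComplL (𝕜 := ℂ) (E := E)).toLinearMap :=
    Completion.denseRange_coe
  have hl' : ∀ g, ‖l g‖ ≤ |N| * ‖(Completion.toComplL (𝕜 := ℂ) (E := E)).toLinearMap g‖ :=
    fun g => by
      have : ‖(Completion.toComplL (𝕜 := ℂ) (E := E)).toLinearMap g‖ = ‖g‖ := Completion.norm_coe g
      rw [this]
      refine (hl g).trans ?_
      gcongr
      exact le_abs_self N
  let L : Completion E →L[ℂ] ℂ :=
    l.extendOfNorm (Completion.toComplL (𝕜 := ℂ) (E := E)).toLinearMap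
  have hL : ∀ g : E, L (g : Completion E) = l g := fun g =>
    LinearMap.extendOfNorm_eq hd ⟨_, hl'⟩ g
  have hLn : ‖L‖ ≤ |N| := LinearMap.opNorm_extendOfNorm_le hd (abs_nonneg N) hl'
  set v := (InnerProductSpace.toDual ℂ (Completion E)).symm L
  have hv : ∀ x, L x = inner ℂ v x := fun x => by simp [v]
  have hvn : ‖v‖ ≤ |N| := by simpa [v] using hLn
  have h1 : ∑ i, ‖L (e i)‖ ^ 2 ≤ N ^ 2 := by
    calc ∑ i, ‖L (e i)‖ ^ 2 = ∑ i, ‖inner ℂ (e i) v‖ ^ 2 := by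
          simp_rw [hv, norm_inner_symm v]
      _ ≤ ‖v‖ ^ 2 := he.sum_inner_products_le v
      _ ≤ |N| ^ 2 := by gcongr
      _ = N ^ 2 := sq_abs N
  calc ∑ i, ‖l (f i)‖ ^ 2
      ≤ ∑ i, (2 * ‖L (e i)‖ ^ 2 + 2 * N ^ 2 * ‖(f i : Completion E) - e i‖ ^ 2) := by
        refine Finset.sum_le_sum fun i _ => ?_
        have h2 : l (f i) = L (e i) + L ((f i : Completion E) - e i) := by
          rw [← hL, map_sub]; ring
        have h3 : ‖L ((f i : Completion E) - e i)‖ ≤ |N| * ‖(f i : Completion E) - e i‖ :=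
          (L.le_opNorm _).trans (by gcongr)
        have h4 : ‖l (f i)‖ ≤ ‖L (e i)‖ + |N| * ‖(f i : Completion E) - e i‖ := by
          rw [h2]
          exact (norm_add_le _ _).trans (by gcongr)
        calc ‖l (f i)‖ ^ 2 ≤ (‖L (e i)‖ + |N| * ‖(f i : Completion E) - e i‖) ^ 2 := by gcongr
          _ ≤ 2 * (‖L (e i)‖ ^ 2 + (|N| * ‖(f i : Completion E) - e i‖) ^ 2) := add_sq_le
          _ = _ := by rw [mul_pow, sq_abs]; ring
    _ = 2 * ∑ i, ‖L (e i)‖ ^ 2 + 2 * N ^ 2 * ∑ i, ‖(f i : Completion E) - e i‖ ^ 2 := by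
        rw [Finset.sum_add_distrib, Finset.mul_sum, Finset.mul_sum]
    _ ≤ 2 * N ^ 2 + 2 * N ^ 2 * 1 := by gcongr
    _ = 4 * N ^ 2 := by ring

/-- To bound the diagonal of an operator on the completion it is enough to consider Bessel
families in the dense subspace. -/
theorem hasBoundedDiagonal_of_isBesselFamily {D : Completion E →L[ℂ] Completion E} {C : ℝ}
    (h : ∀ (s : Finset (Completion E)) (f : s → E), IsBesselFamily f 4 →
      ∑ i, ‖inner ℂ (f i : Completion E) (D (f i : Completion E))‖ ≤ C) :
    HasBoundedDiagonal D := by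
  refine ⟨C, fun s hs => ?_⟩
  by_contra! hlt
  -- If the bound failed at an orthonormal tuple, it would fail on a neighbourhood of it. By density
  -- this contains a tuple from `E` at squared distance less than `1`, which is a Bessel family.
  let G : (s → Completion E) → ℝ := fun v => ∑ i, ‖inner ℂ (v i) (D (v i))‖
  let R : (s → Completion E) → ℝ := fun v => ∑ i, ‖v i - (i : Completion E)‖ ^ 2
  have hG : Continuous G := by fun_prop
  have hR : Continuous R := by fun_prop
  have hd : DenseRange (Pi.map fun (_ : s) (x : E) => (x : Completion E)) :=
    DenseRange.piMap fun _ => Completion.denseRange_coe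
  obtain ⟨f, hf1, hf2⟩ := hd.exists_mem_open
    ((isOpen_lt continuous_const hG).inter (isOpen_lt hR continuous_const))
    (s := {v | C < G v} ∩ {v | R v < 1})
    ⟨fun i => (i : Completion E), by
      change C < ∑ i : s, _
      rw [← Finset.sum_coe_sort] at hlt
      exact hlt, by simp [R]⟩
  exact absurd (h s f (isBesselFamily_of_near hs hf2.le)) (not_le.2 hf1)

end Forms

/-! ### Fourier transforms of test functions -/

section Fourier

/-- Smooth compactly supported complex functions on the line. -/
structure IsTestFunction (h : ℝ → ℂ) : Prop where
  contDiff : ContDiff ℝ ∞ h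
  hasCompactSupport : HasCompactSupport h

namespace IsTestFunction

variable {h g : ℝ → ℂ}

theorem continuous (hh : IsTestFunction h) : Continuous h := hh.contDiff.continuous

theorem integrable (hh : IsTestFunction h) : Integrable h :=
  hh.continuous.integrable_of_hasCompactSupport hh.hasCompactSupport

theorem mul_left (hh : IsTestFunction h) {u : ℝ → ℂ} (hu : ContDiff ℝ ∞ u) :
    IsTestFunction fun x => u x * h x :=
  ⟨hu.mul hh.contDiff, hh.hasCompactSupport.mul_left⟩

theorem mul_right (hh : IsTestFunction h) {u : ℝ → ℂ} (hu : ContDiff ℝ ∞ u) :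
    IsTestFunction fun x => h x * u x :=
  ⟨hh.contDiff.mul hu, hh.hasCompactSupport.mul_right⟩

theorem conjugate (hh : IsTestFunction h) : IsTestFunction fun x => (starRingEnd ℂ) (h x) :=
  ⟨Complex.conjCLE.contDiff.comp hh.contDiff,
    hh.hasCompactSupport.comp_left (g := fun z : ℂ => (starRingEnd ℂ) z) (map_zero _)⟩

theorem sub (hh : IsTestFunction h) (hg : IsTestFunction g) :
    IsTestFunction fun x => h x - g x :=
  ⟨hh.contDiff.sub hg.contDiff, hh.hasCompactSupport.sub hg.hasCompactSupport⟩

theorem integrable_exp_mul (hh : IsTestFunction h) (k : ℝ) :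
    Integrable fun x : ℝ => cexp (-(I * k * x)) * h x :=
  Continuous.integrable_of_hasCompactSupport
    ((by fun_prop : Continuous fun x : ℝ => cexp (-(I * k * x))).mul hh.continuous)
    hh.hasCompactSupport.mul_left

theorem integrable_conj_mul (hh : IsTestFunction h) (hg : IsTestFunction g) :
    Integrable fun x => (starRingEnd ℂ) (h x) * g x :=
  (hg.mul_left hh.conjugate.contDiff).integrable

/-- The Schwartz function given by a test function. -/
def toSchwartz (hh : IsTestFunction h) : SchwartzMap ℝ ℂ :=
  hh.hasCompactSupport.toSchwartzMap hh.contDiff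

theorem exists_schwartz (hh : IsTestFunction h) : ∃ F : SchwartzMap ℝ ℂ, ∀ k, ft h k = F k := by
  have hpi : (2 * Real.pi)⁻¹ ≠ 0 := by positivity
  let e : ℝ ≃L[ℝ] ℝ := ContinuousLinearEquiv.unitsEquivAut ℝ (Units.mk0 _ hpi)
  refine ⟨(((Real.sqrt (2 * Real.pi))⁻¹ : ℝ) : ℂ) •
    SchwartzMap.compCLMOfContinuousLinearEquiv ℂ e (FourierTransform.fourier hh.toSchwartz),
    fun k => ?_⟩
  rw [ft_eq_fourier]
  have he : e k = k / (2 * Real.pi) := by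
    simp [e, div_eq_mul_inv]
  simp only [_root_.smul_apply, SchwartzMap.compCLMOfContinuousLinearEquiv_apply,
    Function.comp_apply, smul_eq_mul, he]
  rfl

theorem continuous_ft (hh : IsTestFunction h) : Continuous (ft h) := by
  obtain ⟨F, hF⟩ := hh.exists_schwartz
  rw [funext hF]
  exact F.continuous

theorem ft_decay (hh : IsTestFunction h) :
    ∃ C : ℝ, 0 ≤ C ∧ ∀ k, ‖ft h k‖ ≤ C * ((1 + |k|) ^ 2)⁻¹ := by
  obtain ⟨F, hF⟩ := hh.exists_schwartz
  obtain ⟨C₀, h₀, hC₀⟩ := F.decay 0 0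
  obtain ⟨C₂, h₂, hC₂⟩ := F.decay 2 0
  -- From `(1 + |k|)² ≤ 2 (1 + k²)`.
  refine ⟨2 * (C₀ + C₂), by positivity, fun k => ?_⟩
  have e0 := hC₀ k
  have e2 := hC₂ k
  simp only [pow_zero, one_mul, norm_iteratedFDeriv_zero, Real.norm_eq_abs] at e0 e2
  rw [hF, ← div_eq_mul_inv, le_div_iff₀ (by positivity)]
  nlinarith [norm_nonneg (F k), sq_nonneg (1 - |k|), mul_nonneg (norm_nonneg (F k))
    (sq_nonneg (1 - |k|))]

/-- Plancherel's formula. -/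
theorem integral_conj_ft_mul_ft (hh : IsTestFunction h) (hg : IsTestFunction g) :
    ∫ k, (starRingEnd ℂ) (ft h k) * ft g k = ∫ x, (starRingEnd ℂ) (h x) * g x := by
  have h1 : ∀ k, (starRingEnd ℂ) (ft h k) * ft g k = (((2 * Real.pi)⁻¹ : ℝ) : ℂ) *
      (fun y => (starRingEnd ℂ) (FourierTransform.fourier hh.toSchwartz y) *
        FourierTransform.fourier hg.toSchwartz y) (k / (2 * Real.pi)) := by
    intro k
    have e : (((2 * Real.pi)⁻¹ : ℝ) : ℂ) = ((Real.sqrt (2 * Real.pi))⁻¹ : ℝ) *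
        ((Real.sqrt (2 * Real.pi))⁻¹ : ℝ) := by
      rw [← ofReal_mul, ← mul_inv, Real.mul_self_sqrt (by positivity)]
    rw [ft_eq_fourier, ft_eq_fourier, map_mul, conj_ofReal, e]
    change _ = _ * ((starRingEnd ℂ) (FourierTransform.fourier h _) * FourierTransform.fourier g _)
    ring
  simp_rw [h1]
  rw [integral_const_mul, Measure.integral_comp_div (fun y => (starRingEnd ℂ)
    (FourierTransform.fourier hh.toSchwartz y) * FourierTransform.fourier hg.toSchwartz y),
    abs_of_pos (by positivity : 0 < 2 * Real.pi),
    real_smul, ← mul_assoc, ← ofReal_mul, inv_mul_cancel₀ (by positivity), ofReal_one, one_mul]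
  have := SchwartzMap.integral_inner_fourier_fourier hh.toSchwartz hg.toSchwartz
  simp only [RCLike.inner_apply] at this
  simp_rw [mul_comm ((starRingEnd ℂ) _)]
  exact this

theorem ft_sub (hh : IsTestFunction h) (hg : IsTestFunction g) (k : ℝ) :
    ft (fun x => h x - g x) k = ft h k - ft g k := by
  simp only [ft]
  rw [← mul_sub, ← integral_sub (hh.integrable_exp_mul k) (hg.integrable_exp_mul k)]
  simp_rw [mul_sub]

theorem hasDerivAt_ft (hh : IsTestFunction h) (k : ℝ) :
    HasDerivAt (ft h) (ft (fun x => -(I * x) * h x) k) k := by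
  have hu : ContDiff ℝ ∞ fun x : ℝ => -(I * (x : ℂ)) :=
    (contDiff_const.mul Complex.ofRealCLM.contDiff).neg
  have hh' := hh.mul_left hu
  have key := hasDerivAt_integral_of_dominated_loc_of_deriv_le (μ := volume)
    (F := fun (k : ℝ) (x : ℝ) => cexp (-(I * k * x)) * h x)
    (F' := fun (k : ℝ) (x : ℝ) => cexp (-(I * k * x)) * (-(I * x) * h x))
    (x₀ := k) (s := Set.univ) (bound := fun x => ‖-(I * x) * h x‖) Filter.univ_mem
    (Filter.Eventually.of_forall fun k => (hh.integrable_exp_mul k).aestronglyMeasurable)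
    (hh.integrable_exp_mul k) (hh'.integrable_exp_mul k).aestronglyMeasurable
    (Filter.Eventually.of_forall fun x k _ => by
      have : ‖cexp (-(I * k * x))‖ = 1 := by
        rw [show -(I * k * x) = ((-(k * x) : ℝ) : ℂ) * I by push_cast; ring]
        exact norm_exp_ofReal_mul_I _
      rw [norm_mul, this, one_mul])
    hh'.integrable.norm
    (Filter.Eventually.of_forall fun x k _ => by
      have h1 : HasDerivAt (fun k : ℝ => -(I * (k : ℂ) * x)) (-(I * 1 * x)) k :=
        ((Complex.ofRealCLM.hasDerivAt.const_mul I).mul_const (x : ℂ)).neg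
      have h2 := (h1.cexp).mul_const (h x)
      exact h2.congr_deriv (by ring))
  exact key.2.const_mul _

theorem ft_exp_mul (h : ℝ → ℂ) (p k : ℝ) :
    ft (fun x => cexp (I * p * x) * h x) k = ft h (k - p) := by
  simp only [ft]
  congr 2
  ext x
  rw [← mul_assoc, ← Complex.exp_add]
  congr 2
  push_cast
  ring

theorem contDiff_exp (p : ℝ) : ContDiff ℝ ∞ fun x : ℝ => cexp (I * p * x) :=
  (contDiff_const.mul Complex.ofRealCLM.contDiff).cexp

theorem ft_zero (h : ℝ → ℂ) : ft h 0 = ((Real.sqrt (2 * Real.pi))⁻¹ : ℝ) * ∫ x, h x := by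
  simp [ft]

end IsTestFunction

theorem isTestFunction_coe {a b : ℝ} (f : TestFn a b) : IsTestFunction f :=
  ⟨f.contDiff, f.hasCompactSupport⟩

theorem sq_integral_mul_le {u v : ℝ → ℝ} (hu : Continuous u) (hv : Continuous v)
    (hu0 : ∀ x, 0 ≤ u x) (hv0 : ∀ x, 0 ≤ v x)
    (hu2 : Integrable fun x => u x ^ 2) (hv2 : Integrable fun x => v x ^ 2) :
    (∫ x, u x * v x) ^ 2 ≤ (∫ x, u x ^ 2) * ∫ x, v x ^ 2 := by
  have hU : MemLp u (ENNReal.ofReal 2) := by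
    rw [ENNReal.ofReal_ofNat]
    exact (memLp_two_iff_integrable_sq hu.aestronglyMeasurable).2 hu2
  have hV : MemLp v (ENNReal.ofReal 2) := by
    rw [ENNReal.ofReal_ofNat]
    exact (memLp_two_iff_integrable_sq hv.aestronglyMeasurable).2 hv2
  have := integral_mul_le_Lp_mul_Lq_of_nonneg (μ := volume) Real.HolderConjugate.two_two
    (Filter.Eventually.of_forall hu0) (Filter.Eventually.of_forall hv0) hU hV
  simp only [Real.rpow_ofNat, ← Real.sqrt_eq_rpow] at this
  have h0 : 0 ≤ ∫ x, u x * v x := integral_nonneg fun x => mul_nonneg (hu0 x) (hv0 x)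
  have hA : 0 ≤ ∫ x, u x ^ 2 := integral_nonneg fun x => sq_nonneg _
  have hB : 0 ≤ ∫ x, v x ^ 2 := integral_nonneg fun x => sq_nonneg _
  calc _ ≤ (√(∫ x, u x ^ 2) * √(∫ x, v x ^ 2)) ^ 2 := by gcongr
    _ = _ := by rw [mul_pow, Real.sq_sqrt hA, Real.sq_sqrt hB]

end Fourier

/-! ### Bounds for point evaluations of Fourier transforms -/

section Evaluation

/-- Splits a translated weight into its size at `k` and a growth in `l` that the cutoff absorbs. -/
theorem one_add_abs_add_le (k l : ℝ) : 1 + |l + k| ≤ (1 + |l|) * (1 + |k|) := by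
  nlinarith [abs_add_le l k, abs_nonneg l, abs_nonneg k, mul_nonneg (abs_nonneg l) (abs_nonneg k)]

theorem abs_le_omega (m k : ℝ) : |k| ≤ omega m k :=
  Real.abs_le_sqrt (by nlinarith [sq_nonneg m])

theorem omega_le {m : ℝ} (hm : 0 < m) (k : ℝ) : omega m k ≤ (1 + m) * (1 + |k|) := by
  refine Real.sqrt_le_iff.2 ⟨by positivity, ?_⟩
  have h1 : |k| ^ 2 ≤ (1 + |k|) ^ 2 := by gcongr; linarith
  have h2 : 1 ≤ (1 + |k|) ^ 2 := by nlinarith [abs_nonneg k]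
  rw [sq_abs] at h1
  calc k ^ 2 + m ^ 2 ≤ (1 + |k|) ^ 2 + m ^ 2 * (1 + |k|) ^ 2 := by nlinarith [sq_nonneg m]
    _ ≤ ((1 + m) * (1 + |k|)) ^ 2 := by nlinarith [sq_nonneg (1 + |k|), mul_pos hm (by positivity :
        0 < (1 + |k|) ^ 2)]

theorem omega_pos {m : ℝ} (hm : 0 < m) (k : ℝ) : 0 < omega m k := hm.trans_le (le_omega m k)

theorem inv_omega_le {m : ℝ} (hm : 0 < m) (k : ℝ) :
    (omega m k)⁻¹ ≤ (1 + m⁻¹) * (1 + |k|)⁻¹ := by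
  have h := omega_pos hm k
  rw [← div_eq_mul_inv, le_div_iff₀ (by positivity), inv_mul_le_iff₀ h]
  have h1 := abs_le_omega m k
  have h2 : 1 ≤ omega m k * m⁻¹ := by
    rw [← div_eq_mul_inv, le_div_iff₀ hm, one_mul]
    exact le_omega m k
  linarith

theorem one_add_abs_sq_inv_le (k : ℝ) : ((1 + |k|) ^ 2)⁻¹ ≤ (1 + k ^ 2)⁻¹ := by
  refine inv_anti₀ (by positivity) ?_
  nlinarith [sq_abs k, abs_nonneg k]

/-- After translating by `k`, the rapid decay of `ft χ` beats the linear growth of the weight. The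
point is uniformity: `B` depends on `χ` alone, and `w` and `k` enter only through `c`. -/
theorem IsTestFunction.integral_weight_le {χ : ℝ → ℂ} (hχ : IsTestFunction χ) :
    ∃ B : ℝ, 0 ≤ B ∧ ∀ (w : ℝ → ℝ), Continuous w → (∀ l, 0 ≤ w l) → ∀ c k : ℝ,
      (∀ l, w (l + k) ≤ c * (1 + |l|)) →
      Integrable (fun l => w l * ‖ft χ (l - k)‖ ^ 2) ∧
        ∫ l, w l * ‖ft χ (l - k)‖ ^ 2 ≤ B * c := by
  obtain ⟨C, hC0, hC⟩ := hχ.ft_decay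
  refine ⟨C ^ 2 * ∫ l : ℝ, (1 + l ^ 2)⁻¹, ?_, fun w hw hw0 c k hc => ?_⟩
  · have : 0 ≤ ∫ l : ℝ, (1 + l ^ 2)⁻¹ := integral_nonneg fun l => by positivity
    positivity
  have hle : ∀ l, w (l + k) * ‖ft χ l‖ ^ 2 ≤ c * C ^ 2 * (1 + l ^ 2)⁻¹ := by
    intro l
    have hc0 : 0 ≤ c * (1 + |l|) := (hw0 _).trans (hc l)
    have hc1 : 0 ≤ c := nonneg_of_mul_nonneg_left hc0 (by positivity)
    have h1 : (1 + |l|) * (((1 + |l|) ^ 2)⁻¹) ^ 2 ≤ ((1 + |l|) ^ 2)⁻¹ := by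
      have hp : 1 ≤ 1 + |l| := by linarith [abs_nonneg l]
      rw [← inv_pow, ← pow_mul]
      have : (1 + |l|) * ((1 + |l|)⁻¹) ^ (2 * 2) = ((1 + |l|)⁻¹) ^ 3 := by
        rw [show 2 * 2 = 3 + 1 from rfl, pow_succ', ← mul_assoc,
          mul_inv_cancel₀ (by positivity), one_mul]
      rw [this]
      exact pow_le_pow_of_le_one (by positivity) (inv_le_one_of_one_le₀ hp) (by norm_num)
    calc w (l + k) * ‖ft χ l‖ ^ 2 ≤ c * (1 + |l|) * (C * ((1 + |l|) ^ 2)⁻¹) ^ 2 := by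
          gcongr
          · exact hc l
          · exact hC l
      _ = c * C ^ 2 * ((1 + |l|) * (((1 + |l|) ^ 2)⁻¹) ^ 2) := by ring
      _ ≤ c * C ^ 2 * (1 + l ^ 2)⁻¹ := by
          gcongr
          exact h1.trans (one_add_abs_sq_inv_le l)
  have hint : Integrable fun l => w (l + k) * ‖ft χ l‖ ^ 2 := by
    refine (integrable_inv_one_add_sq.const_mul (c * C ^ 2)).mono'
      ((hw.comp (by fun_prop : Continuous fun l : ℝ => l + k)).mul
        (hχ.continuous_ft.norm.pow 2)).aestronglyMeasurable
      (Filter.Eventually.of_forall fun l => ?_)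
    rw [Real.norm_of_nonneg (mul_nonneg (hw0 _) (by positivity))]
    exact hle l
  have e : (fun l => w l * ‖ft χ (l - k)‖ ^ 2)
      = fun l => (fun l => w (l + k) * ‖ft χ l‖ ^ 2) (l - k) := by
    ext l; simp
  rw [e]
  refine ⟨hint.comp_sub_right k, ?_⟩
  rw [integral_sub_right_eq_self (fun l => w (l + k) * ‖ft χ l‖ ^ 2) k]
  calc _ ≤ ∫ l : ℝ, c * C ^ 2 * (1 + l ^ 2)⁻¹ :=
        integral_mono hint (integrable_inv_one_add_sq.const_mul _) hle
    _ = _ := by rw [integral_const_mul]; ring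

/-- Plancherel, then Cauchy–Schwarz with the weight distributed as `√w · √w⁻¹`. -/
theorem IsTestFunction.sq_norm_integral_conj_mul_le {h g : ℝ → ℂ} (hh : IsTestFunction h)
    (hg : IsTestFunction g) {w : ℝ → ℝ} (hw : Continuous w) (hw0 : ∀ l, 0 < w l)
    (h1 : Integrable fun l => w l * ‖ft h l‖ ^ 2)
    (h2 : Integrable fun l => (w l)⁻¹ * ‖ft g l‖ ^ 2) :
    ‖∫ x, conj (h x) * g x‖ ^ 2 ≤
      (∫ l, w l * ‖ft h l‖ ^ 2) * ∫ l, (w l)⁻¹ * ‖ft g l‖ ^ 2 := by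
  have e1 : ∀ l, (√(w l) * ‖ft h l‖) ^ 2 = w l * ‖ft h l‖ ^ 2 := fun l => by
    rw [mul_pow, Real.sq_sqrt (hw0 l).le]
  have e2 : ∀ l, (√(w l)⁻¹ * ‖ft g l‖) ^ 2 = (w l)⁻¹ * ‖ft g l‖ ^ 2 := fun l => by
    rw [mul_pow, Real.sq_sqrt (inv_nonneg.2 (hw0 l).le)]
  have e3 : ∀ l, √(w l) * ‖ft h l‖ * (√(w l)⁻¹ * ‖ft g l‖) = ‖conj (ft h l) * ft g l‖ :=
    fun l => by
      have : √(w l) * √(w l)⁻¹ = 1 := by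
        rw [Real.sqrt_inv, mul_inv_cancel₀ (Real.sqrt_ne_zero'.2 (hw0 l))]
      rw [norm_mul, RCLike.norm_conj]
      linear_combination (‖ft h l‖ * ‖ft g l‖) * this
  have hwi : Continuous fun l => (w l)⁻¹ := hw.inv₀ fun l => (hw0 l).ne'
  have key := sq_integral_mul_le (u := fun l => √(w l) * ‖ft h l‖)
    (v := fun l => √(w l)⁻¹ * ‖ft g l‖)
    (hw.sqrt.mul hh.continuous_ft.norm) (hwi.sqrt.mul hg.continuous_ft.norm)
    (fun l => by positivity) (fun l => by positivity)
    (by simpa only [e1] using h1) (by simpa only [e2] using h2)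
  simp only [e1, e2, e3] at key
  rw [← hh.integral_conj_ft_mul_ft hg]
  refine le_trans ?_ key
  gcongr
  exact norm_integral_le_integral_norm _

/-- Evaluation of the Fourier transform of `χ g` at a point, bounded by a weighted norm of the
Fourier transform of `g`. -/
theorem IsTestFunction.sq_norm_ft_mul_le {χ : ℝ → ℂ} (hχ : IsTestFunction χ) :
    ∃ B : ℝ, 0 ≤ B ∧ ∀ (w : ℝ → ℝ), Continuous w → (∀ l, 0 < w l) → ∀ c k : ℝ,
      (∀ l, w (l + k) ≤ c * (1 + |l|)) → ∀ g : ℝ → ℂ, IsTestFunction g →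
      Integrable (fun l => (w l)⁻¹ * ‖ft g l‖ ^ 2) →
      ‖ft (fun x => χ x * g x) k‖ ^ 2 ≤ B * c * ∫ l, (w l)⁻¹ * ‖ft g l‖ ^ 2 := by
  obtain ⟨B, hB0, hB⟩ := hχ.conjugate.integral_weight_le
  refine ⟨(((Real.sqrt (2 * Real.pi))⁻¹)) ^ 2 * B, by positivity,
    fun w hw hw0 c k hc g hg hgi => ?_⟩
  obtain ⟨h1, h2⟩ := hB w hw (fun l => (hw0 l).le) c k hc
  -- The value at `k` is the pairing of `g` with the modulated cutoff `e^{ikx} conj χ`, whose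
  -- Fourier transform is that of `conj χ` translated by `k`.
  have hh := hχ.conjugate.mul_left (IsTestFunction.contDiff_exp k)
  simp only [← IsTestFunction.ft_exp_mul (fun x => conj (χ x)) k] at h1 h2
  have key := hh.sq_norm_integral_conj_mul_le hg hw hw0 h1 hgi
  have e : ft (fun x => χ x * g x) k = ((Real.sqrt (2 * Real.pi))⁻¹ : ℝ) *
      ∫ x : ℝ, conj (cexp (I * k * x) * conj (χ x)) * g x := by
    rw [ft]
    congr 2
    ext x
    rw [map_mul, conj_conj, ← exp_conj, map_mul, map_mul, conj_I, conj_ofReal, conj_ofReal,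
      neg_mul, neg_mul]
    ring
  have h0 : 0 ≤ ∫ l, (w l)⁻¹ * ‖ft g l‖ ^ 2 := integral_nonneg fun l => by
    have := hw0 l
    positivity
  rw [e, norm_mul, mul_pow, norm_real, Real.norm_eq_abs, sq_abs, mul_assoc, mul_assoc,
    ← mul_assoc B]
  refine mul_le_mul_of_nonneg_left (key.trans ?_) (by positivity)
  gcongr

theorem integrable_omega_mul {m : ℝ} (hm : 0 < m) {g : ℝ → ℂ} (hg : IsTestFunction g) :
    Integrable (fun k => omega m k * ‖ft g k‖ ^ 2) ∧
      Integrable fun k => (omega m k)⁻¹ * ‖ft g k‖ ^ 2 := by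
  obtain ⟨F, hF⟩ := hg.exists_schwartz
  obtain ⟨h1, h2⟩ := integrable_weight hm F F
  simp only [hF]
  refine ⟨h1.norm.congr (Filter.Eventually.of_forall fun k => ?_),
    h2.norm.congr (Filter.Eventually.of_forall fun k => ?_)⟩
  · simp only [norm_mul, norm_real, RCLike.norm_conj, Real.norm_of_nonneg (omega_nonneg m k)]
    ring
  · simp only [norm_mul, norm_real, RCLike.norm_conj,
      Real.norm_of_nonneg (inv_nonneg.2 (omega_nonneg m k))]
    ring

namespace TestPair

variable {m : ℝ} {hm : 0 < m} {a b : ℝ}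

theorem norm_sq_eq (f : TestPair m hm a b) :
    ‖f‖ ^ 2 = 1 / 2 * ((∫ k, (omega m k)⁻¹ * ‖ft f.1 k‖ ^ 2)
      + ∫ k, omega m k * ‖ft f.2 k‖ ^ 2) := by
  rw [← inner_self_eq_norm_sq (𝕜 := ℂ), inner_eq, symmetrize_massiveTwoPoint,
    ← integral_add (integrable_omega_mul hm (isTestFunction_coe f.1)).2
      (integrable_omega_mul hm (isTestFunction_coe f.2)).1]
  have h : ∀ k : ℝ, (((omega m k)⁻¹ : ℝ) : ℂ) * (conj (ft f.toFun.1 k) * ft f.toFun.1 k)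
      + (omega m k : ℂ) * (conj (ft f.toFun.2 k) * ft f.toFun.2 k)
      = (((omega m k)⁻¹ * ‖ft f.1 k‖ ^ 2 + omega m k * ‖ft f.2 k‖ ^ 2 : ℝ) : ℂ) := fun k => by
    rw [conj_mul', conj_mul']
    push_cast
    rfl
  simp only [h]
  rw [integral_complex_ofReal, show (1 / 2 : ℂ) = ((1 / 2 : ℝ) : ℂ) by norm_num, ← ofReal_mul]
  exact ofReal_re _

theorem integral_inv_omega_le (f : TestPair m hm a b) :
    ∫ k, (omega m k)⁻¹ * ‖ft f.1 k‖ ^ 2 ≤ 2 * ‖f‖ ^ 2 := by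
  have h : 0 ≤ ∫ k, omega m k * ‖ft f.2 k‖ ^ 2 := integral_nonneg fun k =>
    mul_nonneg (omega_nonneg m k) (by positivity)
  rw [norm_sq_eq]
  linarith

theorem integral_omega_le (f : TestPair m hm a b) :
    ∫ k, omega m k * ‖ft f.2 k‖ ^ 2 ≤ 2 * ‖f‖ ^ 2 := by
  have h : 0 ≤ ∫ k, (omega m k)⁻¹ * ‖ft f.1 k‖ ^ 2 := integral_nonneg fun k =>
    mul_nonneg (inv_nonneg.2 (omega_nonneg m k)) (by positivity)
  rw [norm_sq_eq]
  linarith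

/-- The norm controls `f̂₁` with weight `ω⁻¹`, so the dual weight `ω`, of size `1 + |k|` near `k`,
sets the growth. -/
theorem sq_norm_ft_mul_fst_le {χ : ℝ → ℂ} (hχ : IsTestFunction χ) :
    ∃ C : ℝ, 0 ≤ C ∧ ∀ (f : TestPair m hm a b) (k : ℝ),
      ‖ft (fun x => χ x * f.1 x) k‖ ^ 2 ≤ C * (1 + |k|) * ‖f‖ ^ 2 := by
  obtain ⟨B, hB0, hB⟩ := hχ.sq_norm_ft_mul_le
  refine ⟨B * (1 + m) * 2, by positivity, fun f k => ?_⟩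
  refine (hB (omega m) (continuous_omega m) (omega_pos hm) ((1 + m) * (1 + |k|)) k (fun l => ?_)
    f.1 (isTestFunction_coe _) (integrable_omega_mul hm (isTestFunction_coe _)).2).trans ?_
  · calc omega m (l + k) ≤ (1 + m) * (1 + |l + k|) := omega_le hm _
      _ ≤ (1 + m) * ((1 + |l|) * (1 + |k|)) := by
        gcongr
        exact one_add_abs_add_le k l
      _ = _ := by ring
  · calc _ ≤ B * ((1 + m) * (1 + |k|)) * (2 * ‖f‖ ^ 2) := by
          gcongr
          exact integral_inv_omega_le f
      _ = _ := by ring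

/-- Here the norm carries the weight `ω`, so the dual weight `ω⁻¹` gives decay in `k`. -/
theorem sq_norm_ft_mul_snd_le {χ : ℝ → ℂ} (hχ : IsTestFunction χ) :
    ∃ C : ℝ, 0 ≤ C ∧ ∀ (f : TestPair m hm a b) (k : ℝ),
      ‖ft (fun x => χ x * f.2 x) k‖ ^ 2 ≤ C * (1 + |k|)⁻¹ * ‖f‖ ^ 2 := by
  obtain ⟨B, hB0, hB⟩ := hχ.sq_norm_ft_mul_le
  refine ⟨B * (1 + m⁻¹) * 2, by positivity, fun f k => ?_⟩
  refine (hB (fun l => (omega m l)⁻¹)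
    ((continuous_omega m).inv₀ fun l => (omega_pos hm l).ne')
    (fun l => inv_pos.2 (omega_pos hm l)) ((1 + m⁻¹) * (1 + |k|)⁻¹) k (fun l => ?_)
    f.2 (isTestFunction_coe _) ?_).trans ?_
  · have h1 : (1 + |l + k|)⁻¹ ≤ (1 + |l|) * (1 + |k|)⁻¹ := by
      rw [← div_eq_mul_inv, le_div_iff₀ (by positivity), inv_mul_le_iff₀ (by positivity)]
      have := one_add_abs_add_le (-l) (l + k)
      rw [add_neg_cancel_comm, abs_neg] at this
      exact this
    calc (omega m (l + k))⁻¹ ≤ (1 + m⁻¹) * (1 + |l + k|)⁻¹ := inv_omega_le hm _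
      _ ≤ (1 + m⁻¹) * ((1 + |l|) * (1 + |k|)⁻¹) := by gcongr
      _ = _ := by ring
  · simpa only [inv_inv] using (integrable_omega_mul hm (isTestFunction_coe f.2)).1
  · simp only [inv_inv]
    calc _ ≤ B * ((1 + m⁻¹) * (1 + |k|)⁻¹) * (2 * ‖f‖ ^ 2) := by
          gcongr
          exact integral_omega_le f
      _ = _ := by ring

theorem sq_norm_integral_snd_le {ψ : ℝ → ℂ} (hψ : IsTestFunction ψ) :
    ∃ C : ℝ, 0 ≤ C ∧ ∀ f : TestPair m hm a b,
      ‖∫ x, conj (ψ x) * f.2 x‖ ^ 2 ≤ C * ‖f‖ ^ 2 := by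
  have h0 : 0 ≤ ∫ k, (omega m k)⁻¹ * ‖ft ψ k‖ ^ 2 := integral_nonneg fun k =>
    mul_nonneg (inv_nonneg.2 (omega_nonneg m k)) (by positivity)
  refine ⟨(∫ k, (omega m k)⁻¹ * ‖ft ψ k‖ ^ 2) * 2, by positivity, fun f => ?_⟩
  refine (hψ.sq_norm_integral_conj_mul_le (isTestFunction_coe f.2) (w := fun l => (omega m l)⁻¹)
    ((continuous_omega m).inv₀ fun l => (omega_pos hm l).ne')
    (fun l => inv_pos.2 (omega_pos hm l)) (integrable_omega_mul hm hψ).2 ?_).trans ?_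
  · simpa only [inv_inv] using (integrable_omega_mul hm (isTestFunction_coe f.2)).1
  · simp only [inv_inv]
    rw [mul_assoc]
    gcongr
    exact integral_omega_le f

end TestPair

/-- A smooth cutoff function which equals one on `[a,b]`. -/
theorem exists_cutoff (a b : ℝ) : ∃ χ : ℝ → ℂ, IsTestFunction χ ∧ ∀ x ∈ Set.Icc a b, χ x = 1 := by
  let φ : ContDiffBump (0 : ℝ) := ⟨|a| + |b| + 1, |a| + |b| + 2, by positivity, by linarith⟩
  refine ⟨fun x => (φ x : ℂ), ⟨Complex.ofRealCLM.contDiff.comp φ.contDiff,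
    φ.hasCompactSupport.comp_left ofReal_zero⟩, fun x hx => ?_⟩
  have : φ x = 1 := φ.one_of_mem_closedBall (by
    rw [mem_closedBall_zero_iff, Real.norm_eq_abs, abs_le]
    have := neg_abs_le a
    have := le_abs_self b
    have := abs_nonneg a
    have := abs_nonneg b
    constructor <;> linarith [hx.1, hx.2])
  simp [this]

/-- Localization in `I` enters the evaluation bounds here: `f̂(k)` becomes the pairing of `f` with a
compactly supported function independent of `f`. -/
theorem cutoff_mul {a b : ℝ} {χ : ℝ → ℂ} (hχ : ∀ x ∈ Set.Icc a b, χ x = 1) (f : TestFn a b) :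
    (fun x => χ x * f x) = f := by
  ext x
  by_cases hx : x ∈ Set.Icc a b
  · rw [hχ x hx, one_mul]
  · have : f x = 0 := f.zero_on_compl hx
    rw [this, mul_zero]

end Evaluation

/-! ### Positive forms from `L²` amplitudes and rank-one terms -/

section PositiveForms

variable {E : Type*} [SeminormedAddCommGroup E] [InnerProductSpace ℂ E]

theorem IsPositiveForm.add {W V : E → E → ℂ} (hW : IsPositiveForm W) (hV : IsPositiveForm V) :
    IsPositiveForm fun f g => W f g + V f g where
  add_right f g h := by rw [hW.add_right, hV.add_right]; ring
  smul_right c f g := by rw [hW.smul_right, hV.smul_right]; ring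
  conj_symm f g := by rw [map_add, hW.conj_symm, hV.conj_symm]
  re_nonneg f := by
    rw [add_re]
    exact add_nonneg (hW.re_nonneg f) (hV.re_nonneg f)

theorem conj_half : conj (1 / 2 : ℂ) = 1 / 2 := by
  simp [Complex.ext_iff]

theorem isPositiveForm_rankOne (β : E →ₗ[ℂ] ℂ) :
    IsPositiveForm fun f g => 1 / 2 * conj (β f) * β g where
  add_right f g h := by rw [map_add]; ring
  smul_right c f g := by rw [map_smul, smul_eq_mul]; ring
  conj_symm f g := by rw [map_mul, map_mul, conj_conj, conj_half]; ring
  re_nonneg f := by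
    rw [mul_assoc, conj_mul', show (1 / 2 : ℂ) = ((1 / 2 : ℝ) : ℂ) by norm_num, ← ofReal_pow,
      ← ofReal_mul, ofReal_re]
    positivity

theorem re_half_integral_conj_mul_self_nonneg (φ : ℝ → ℂ) :
    0 ≤ (1 / 2 * ∫ k, conj (φ k) * φ k).re := by
  have h : ∀ k, conj (φ k) * φ k = ((‖φ k‖ ^ 2 : ℝ) : ℂ) := fun k => by
    rw [conj_mul']; push_cast; rfl
  simp only [h]
  rw [integral_complex_ofReal, show (1 / 2 : ℂ) = ((1 / 2 : ℝ) : ℂ) by norm_num, ← ofReal_mul,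
    ofReal_re]
  have : 0 ≤ ∫ k, ‖φ k‖ ^ 2 := integral_nonneg fun k => by positivity
  positivity

theorem integrable_conj_mul_of_memLp {u v : ℝ → ℂ} (hu : MemLp u 2) (hv : MemLp v 2) :
    Integrable fun k => conj (u k) * v k :=
  MemLp.integrable_mul (hu.star) hv

theorem isPositiveForm_integral {φ : E → ℝ → ℂ} (hadd : ∀ f g k, φ (f + g) k = φ f k + φ g k)
    (hsmul : ∀ (c : ℂ) f k, φ (c • f) k = c * φ f k) (hφ : ∀ f, MemLp (φ f) 2) :
    IsPositiveForm fun f g => 1 / 2 * ∫ k, conj (φ f k) * φ g k where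
  add_right f g h := by
    rw [← mul_add, ← integral_add (integrable_conj_mul_of_memLp (hφ f) (hφ g))
      (integrable_conj_mul_of_memLp (hφ f) (hφ h))]
    simp only [hadd, mul_add]
  smul_right c f g := by
    rw [mul_left_comm c, ← integral_const_mul c]
    simp only [hsmul, mul_left_comm c]
  conj_symm f g := by
    rw [map_mul, conj_half, ← integral_conj]
    simp only [map_mul, conj_conj, mul_comm]
  re_nonneg f := re_half_integral_conj_mul_self_nonneg _

end PositiveForms

/-! ### The two-point functions as `L²` products, and their difference -/

section TwoPoint

theorem IsTestFunction.memLp_ft {h : ℝ → ℂ} (hh : IsTestFunction h) : MemLp (ft h) 2 := by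
  obtain ⟨F, hF⟩ := hh.exists_schwartz
  rw [funext hF]
  exact F.memLp 2

/-- The amplitude whose `L²` products give the massive two-point function. -/
def massiveAmplitude (m : ℝ) (p : (ℝ → ℂ) × (ℝ → ℂ)) (k : ℝ) : ℂ :=
  ((√(omega m k)⁻¹ : ℝ) : ℂ) * ft p.1 k + I * ((√(omega m k) : ℝ) : ℂ) * ft p.2 k

theorem memLp_mul_of_integrable {w : ℝ → ℝ} (hw : Measurable w) {h : ℝ → ℂ}
    (hh : IsTestFunction h) (hi : Integrable fun k => w k ^ 2 * ‖ft h k‖ ^ 2) :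
    MemLp (fun k => (w k : ℂ) * ft h k) 2 := by
  have hmeas : Measurable fun k => (w k : ℂ) * ft h k :=
    (measurable_ofReal.comp hw).mul hh.continuous_ft.measurable
  refine (memLp_two_iff_integrable_sq_norm hmeas.aestronglyMeasurable).2 ?_
  simpa only [norm_mul, norm_real, mul_pow, Real.norm_eq_abs, sq_abs] using hi

theorem memLp_massiveAmplitude {m : ℝ} (hm : 0 < m) {p : (ℝ → ℂ) × (ℝ → ℂ)}
    (h₁ : IsTestFunction p.1) (h₂ : IsTestFunction p.2) : MemLp (massiveAmplitude m p) 2 := by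
  have hω : Continuous fun k => (omega m k)⁻¹ :=
    (continuous_omega m).inv₀ fun k => (omega_pos hm k).ne'
  have a1 := memLp_mul_of_integrable hω.sqrt.measurable h₁ (by
    simpa only [Real.sq_sqrt (inv_nonneg.2 (omega_nonneg m _))] using
      (integrable_omega_mul hm h₁).2)
  have a2 := memLp_mul_of_integrable (continuous_omega m).sqrt.measurable h₂ (by
    simpa only [Real.sq_sqrt (omega_nonneg m _)] using (integrable_omega_mul hm h₂).1)
  refine (a1.add (a2.const_mul I)).ae_eq (Filter.Eventually.of_forall fun k => ?_)
  simp only [massiveAmplitude, Pi.add_apply]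
  ring

theorem gammaForm_eq {p q : (ℝ → ℂ) × (ℝ → ℂ)} (hp₁ : IsTestFunction p.1)
    (hp₂ : IsTestFunction p.2) (hq₁ : IsTestFunction q.1) (hq₂ : IsTestFunction q.2) :
    gammaForm p q = (∫ x, conj (p.1 x) * q.2 x) - ∫ x, conj (p.2 x) * q.1 x :=
  integral_sub (hp₁.integrable_conj_mul hq₂) (hp₂.integrable_conj_mul hq₁)

/-- The cross terms of the amplitudes carry `√ω⁻¹ √ω = 1`, so Plancherel turns them into the `γ`
term. This exhibits positivity, invisible in the original expression. -/
theorem massiveTwoPoint_eq {m : ℝ} (hm : 0 < m) {p q : (ℝ → ℂ) × (ℝ → ℂ)}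
    (hp₁ : IsTestFunction p.1) (hp₂ : IsTestFunction p.2) (hq₁ : IsTestFunction q.1)
    (hq₂ : IsTestFunction q.2) :
    massiveTwoPoint m p q =
      1 / 2 * ∫ k, conj (massiveAmplitude m p k) * massiveAmplitude m q k := by
  have i1 : Integrable fun k : ℝ => (((omega m k)⁻¹ : ℝ) * (conj (ft p.1 k) * ft q.1 k)
      + (omega m k : ℂ) * (conj (ft p.2 k) * ft q.2 k)) := by
    obtain ⟨F₁, hF₁⟩ := hp₁.exists_schwartz
    obtain ⟨F₂, hF₂⟩ := hp₂.exists_schwartz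
    obtain ⟨G₁, hG₁⟩ := hq₁.exists_schwartz
    obtain ⟨G₂, hG₂⟩ := hq₂.exists_schwartz
    simp only [hF₁, hF₂, hG₁, hG₂]
    exact (integrable_weight hm F₁ G₁).2.add (integrable_weight hm F₂ G₂).1
  have i2 := integrable_conj_mul_of_memLp hp₁.memLp_ft hq₂.memLp_ft
  have i3 := integrable_conj_mul_of_memLp hp₂.memLp_ft hq₁.memLp_ft
  have i4 : Integrable fun k => I * (conj (ft p.1 k) * ft q.2 k - conj (ft p.2 k) * ft q.1 k) :=
    (i2.sub i3).const_mul I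
  rw [massiveTwoPoint, gammaForm_eq hp₁ hp₂ hq₁ hq₂, ← hp₁.integral_conj_ft_mul_ft hq₂,
    ← hp₂.integral_conj_ft_mul_ft hq₁, ← integral_sub i2 i3, div_eq_mul_one_div I, mul_comm I,
    mul_assoc, ← mul_add, ← integral_const_mul, ← integral_add i1 i4]
  congr 2
  ext k
  have s1 : ((√(omega m k)⁻¹ : ℝ) : ℂ) * ((√(omega m k)⁻¹ : ℝ) : ℂ) = ((omega m k)⁻¹ : ℝ) := by
    rw [← ofReal_mul, Real.mul_self_sqrt (inv_nonneg.2 (omega_nonneg m k))]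
  have s2 : ((√(omega m k) : ℝ) : ℂ) * ((√(omega m k) : ℝ) : ℂ) = (omega m k : ℂ) := by
    rw [← ofReal_mul, Real.mul_self_sqrt (omega_nonneg m k)]
  have s3 : ((√(omega m k)⁻¹ : ℝ) : ℂ) * ((√(omega m k) : ℝ) : ℂ) = 1 := by
    rw [← ofReal_mul, Real.sqrt_inv, inv_mul_cancel₀ (Real.sqrt_ne_zero'.2 (omega_pos hm k)),
      ofReal_one]
  simp only [massiveAmplitude, map_add, map_mul, conj_ofReal, conj_I]
  linear_combination (-(conj (ft p.1 k) * ft q.1 k)) * s1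
    - (conj (ft p.2 k) * ft q.2 k) * s2
    - I * (conj (ft p.1 k) * ft q.2 k - conj (ft p.2 k) * ft q.1 k) * s3
    + ((√(omega m k) : ℝ) : ℂ) * ((√(omega m k) : ℝ) : ℂ) * (conj (ft p.2 k) * ft q.2 k) * I_mul_I

variable {ψ : ℝ → ℝ}

theorem isTestFunction_ofReal (hψ : ContDiff ℝ ∞ ψ) (hψ_supp : HasCompactSupport ψ) :
    IsTestFunction fun x => (ψ x : ℂ) :=
  ⟨Complex.ofRealCLM.contDiff.comp hψ, hψ_supp.comp_left ofReal_zero⟩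

theorem isTestFunction_projPsi (hψ : IsTestFunction fun x => (ψ x : ℂ)) {h : ℝ → ℂ}
    (hh : IsTestFunction h) : IsTestFunction (projPsi ψ h) :=
  hh.sub (hψ.mul_right contDiff_const)

theorem ft_mul_const (h : ℝ → ℂ) (c : ℂ) (k : ℝ) : ft (fun x => h x * c) k = ft h k * c := by
  simp only [ft, ← mul_assoc]
  rw [integral_mul_const, mul_assoc]

theorem ft_projPsi (hψ : IsTestFunction fun x => (ψ x : ℂ)) {h : ℝ → ℂ}
    (hh : IsTestFunction h) (k : ℝ) :
    ft (projPsi ψ h) k = ft h k - ft (fun x => (ψ x : ℂ)) k * ∫ x, h x := by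
  rw [← ft_mul_const]
  exact hh.ft_sub (hψ.mul_right contDiff_const) k

theorem ft_projPsi_zero (hψ : IsTestFunction fun x => (ψ x : ℂ)) (hψ_int : ∫ x, ψ x = 1)
    {h : ℝ → ℂ} (hh : IsTestFunction h) : ft (projPsi ψ h) 0 = 0 := by
  rw [ft_projPsi hψ hh, IsTestFunction.ft_zero, IsTestFunction.ft_zero, integral_complex_ofReal,
    hψ_int, ofReal_one, mul_one, sub_self]

/-- A bounded derivative and a zero at the origin give `‖ft h k‖ ≤ C |k|`; one factor cancels the
singularity and the other remains integrable. -/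
theorem IsTestFunction.integrable_inv_abs_mul {h : ℝ → ℂ} (hh : IsTestFunction h)
    (h0 : ft h 0 = 0) : Integrable fun k => |k|⁻¹ * ‖ft h k‖ ^ 2 := by
  have hu : ContDiff ℝ ∞ fun x : ℝ => -(I * (x : ℂ)) :=
    (contDiff_const.mul Complex.ofRealCLM.contDiff).neg
  obtain ⟨C, hC0, hC⟩ := (hh.mul_left hu).ft_decay
  have hlip : ∀ k, ‖ft h k‖ ≤ C * |k| := by
    intro k
    have := convex_univ.norm_image_sub_le_of_norm_hasDerivWithin_le (f := ft h) (C := C)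
      (x := 0) (y := k) (fun x _ => (hh.hasDerivAt_ft x).hasDerivWithinAt)
      (fun x _ => (hC x).trans (mul_le_of_le_one_right hC0 (inv_le_one_of_one_le₀
        (one_le_pow₀ (by linarith [abs_nonneg x]))))) (Set.mem_univ _) (Set.mem_univ _)
    simpa [h0] using this
  obtain ⟨F, hF⟩ := hh.exists_schwartz
  have hint : Integrable fun k => C * ‖ft h k‖ := by
    simp only [hF]
    exact F.integrable.norm.const_mul C
  refine hint.mono' ?_ (Filter.Eventually.of_forall fun k => ?_)
  · exact ((measurable_id.abs.inv).mul (hh.continuous_ft.norm.pow 2).measurable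
      ).aestronglyMeasurable
  · rw [Real.norm_of_nonneg (by positivity)]
    rcases eq_or_ne k 0 with rfl | hk
    · simp [h0]
    · rw [inv_mul_le_iff₀ (abs_pos.2 hk), sq, ← mul_assoc, mul_comm |k|]
      gcongr
      exact hlip k

theorem IsTestFunction.integrable_abs_mul {h : ℝ → ℂ} (hh : IsTestFunction h) :
    Integrable fun k => |k| * ‖ft h k‖ ^ 2 := by
  refine (integrable_omega_mul one_pos hh).1.mono'
    (measurable_id.abs.mul (hh.continuous_ft.norm.pow 2).measurable).aestronglyMeasurable
    (Filter.Eventually.of_forall fun k => ?_)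
  rw [Real.norm_of_nonneg (by positivity)]
  gcongr
  exact abs_le_omega 1 k

/-- The amplitude whose `L²` products give the regular part of the Schubert two-point function. -/
def schubertAmplitude (ψ : ℝ → ℝ) (p : (ℝ → ℂ) × (ℝ → ℂ)) (k : ℝ) : ℂ :=
  ((|k| ^ (-(1 / 2) : ℝ) : ℝ) : ℂ) * ft (projPsi ψ p.1) k
    + I * ((|k| ^ (1 / 2 : ℝ) : ℝ) : ℂ) * ft p.2 k

/-- The charge functional of the Schubert state. -/
def schubertCharge (ψ : ℝ → ℝ) (r : ℝ) (p : (ℝ → ℂ) × (ℝ → ℂ)) : ℂ :=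
  r * (∫ x, p.1 x) + I / r * ∫ x, (ψ x : ℂ) * p.2 x

theorem memLp_schubertAmplitude (hψ : IsTestFunction fun x => (ψ x : ℂ)) (hψ_int : ∫ x, ψ x = 1)
    {p : (ℝ → ℂ) × (ℝ → ℂ)} (h₁ : IsTestFunction p.1) (h₂ : IsTestFunction p.2) :
    MemLp (schubertAmplitude ψ p) 2 := by
  have e1 : ∀ k : ℝ, (|k| ^ (-(1 / 2) : ℝ)) ^ 2 = |k|⁻¹ := fun k => by
    rw [← Real.rpow_natCast, ← Real.rpow_mul (abs_nonneg k)]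
    norm_num [Real.rpow_neg_one]
  have e2 : ∀ k : ℝ, (|k| ^ (1 / 2 : ℝ)) ^ 2 = |k| := fun k => by
    rw [← Real.sqrt_eq_rpow, Real.sq_sqrt (abs_nonneg k)]
  have hP := isTestFunction_projPsi hψ h₁
  have a1 := memLp_mul_of_integrable (w := fun k => |k| ^ (-(1 / 2) : ℝ))
    (measurable_id.abs.pow_const _) hP (by
      simpa only [e1] using hP.integrable_inv_abs_mul (ft_projPsi_zero hψ hψ_int h₁))
  have a2 := memLp_mul_of_integrable (w := fun k => |k| ^ (1 / 2 : ℝ))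
    (measurable_id.abs.pow_const _) h₂ (by simpa only [e2] using h₂.integrable_abs_mul)
  refine (a1.add (a2.const_mul I)).ae_eq (Filter.Eventually.of_forall fun k => ?_)
  simp only [schubertAmplitude, Pi.add_apply]
  ring

theorem schubertTwoPoint_eq (hψ : IsTestFunction fun x => (ψ x : ℂ)) (r : ℝ)
    {p q : (ℝ → ℂ) × (ℝ → ℂ)} (hp₁ : IsTestFunction p.1) (hp₂ : IsTestFunction p.2)
    (hq₁ : IsTestFunction q.1) (hq₂ : IsTestFunction q.2) :
    schubertTwoPoint ψ r p q =
      1 / 2 * (∫ k, conj (schubertAmplitude ψ p k) * schubertAmplitude ψ q k)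
      + 1 / 2 * conj (schubertCharge ψ r p) * schubertCharge ψ r q := by
  have hch : ∀ {p : (ℝ → ℂ) × (ℝ → ℂ)}, IsTestFunction p.1 → IsTestFunction p.2 →
      ∫ x : ℝ, ((r : ℂ) * p.1 x + I / r * ψ x * p.2 x) = schubertCharge ψ r p := by
    intro p h₁ h₂
    simp only [mul_assoc]
    rw [integral_add (h₁.integrable.const_mul _)
      ((h₂.mul_left hψ.contDiff).integrable.const_mul _), integral_const_mul, integral_const_mul,
      schubertCharge]
  rw [schubertTwoPoint, hch hq₁ hq₂, ← hch hp₁ hp₂, ← integral_conj]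
  congr 2
  · congr 2
    ext k
    simp only [schubertAmplitude, map_add, map_mul, conj_ofReal, conj_I]
    ring
  · congr 2
    ext x
    simp only [map_add, map_mul, map_div₀, conj_ofReal, conj_I]
    ring

/-- The difference of the two-point functions on the diagonal; the antisymmetric parts cancel. -/
theorem massiveTwoPoint_sub_schubertTwoPoint {m : ℝ} (hm : 0 < m)
    (hψ : IsTestFunction fun x => (ψ x : ℂ)) (hψ_int : ∫ x, ψ x = 1) {r : ℝ} (hr : 0 < r)
    {p : (ℝ → ℂ) × (ℝ → ℂ)} (h₁ : IsTestFunction p.1) (h₂ : IsTestFunction p.2) :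
    massiveTwoPoint m p p - schubertTwoPoint ψ r p p =
      ((1 / 2 * (∫ k, (((omega m k)⁻¹ * ‖ft p.1 k‖ ^ 2 + omega m k * ‖ft p.2 k‖ ^ 2)
          - (|k|⁻¹ * ‖ft (projPsi ψ p.1) k‖ ^ 2 + |k| * ‖ft p.2 k‖ ^ 2)))
        - 1 / 2 * r ^ 2 * ‖∫ x, p.1 x‖ ^ 2
        - 1 / 2 * (r ^ 2)⁻¹ * ‖∫ x, (ψ x : ℂ) * p.2 x‖ ^ 2 : ℝ) : ℂ) := by
  have hP := isTestFunction_projPsi hψ h₁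
  have im : Integrable fun k => (omega m k)⁻¹ * ‖ft p.1 k‖ ^ 2 + omega m k * ‖ft p.2 k‖ ^ 2 :=
    (integrable_omega_mul hm h₁).2.add (integrable_omega_mul hm h₂).1
  have is : Integrable fun k => |k|⁻¹ * ‖ft (projPsi ψ p.1) k‖ ^ 2 + |k| * ‖ft p.2 k‖ ^ 2 :=
    (hP.integrable_inv_abs_mul (ft_projPsi_zero hψ hψ_int h₁)).add h₂.integrable_abs_mul
  have i2 := integrable_conj_mul_of_memLp hP.memLp_ft h₂.memLp_ft
  have i3 := integrable_conj_mul_of_memLp h₂.memLp_ft hP.memLp_ft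
  have i4 : Integrable fun k => I * (conj (ft (projPsi ψ p.1) k) * ft p.2 k
      - conj (ft p.2 k) * ft (projPsi ψ p.1) k) := (i2.sub i3).const_mul I
  have is' : Integrable fun k =>
      ((|k|⁻¹ * ‖ft (projPsi ψ p.1) k‖ ^ 2 + |k| * ‖ft p.2 k‖ ^ 2 : ℝ) : ℂ) := is.ofReal
  have eM : massiveTwoPoint m p p = 1 / 2 * ((∫ k, ((omega m k)⁻¹ * ‖ft p.1 k‖ ^ 2
      + omega m k * ‖ft p.2 k‖ ^ 2) : ℝ) : ℂ)
      + I / 2 * ((∫ x, conj (p.1 x) * p.2 x) - ∫ x, conj (p.2 x) * p.1 x) := by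
    rw [massiveTwoPoint, gammaForm_eq h₁ h₂ h₁ h₂, ← integral_complex_ofReal]
    congr 3
    ext k
    rw [conj_mul', conj_mul']
    push_cast
    ring
  have eA : ∫ k, conj (schubertAmplitude ψ p k) * schubertAmplitude ψ p k =
      ((∫ k, (|k|⁻¹ * ‖ft (projPsi ψ p.1) k‖ ^ 2 + |k| * ‖ft p.2 k‖ ^ 2) : ℝ) : ℂ)
      + I * ((∫ x, conj (projPsi ψ p.1 x) * p.2 x) - ∫ x, conj (p.2 x) * projPsi ψ p.1 x) := by
    rw [← hP.integral_conj_ft_mul_ft h₂, ← h₂.integral_conj_ft_mul_ft hP, ← integral_sub i2 i3,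
      ← integral_const_mul, ← integral_complex_ofReal,
      ← integral_add is' i4]
    refine integral_congr_ae ?_
    -- At `k = 0` the product of the two powers of `|k|` is `0` rather than `1`; the point is a null
    -- set.
    have hne : ∀ᵐ k : ℝ, k ≠ 0 := by
      simp [ae_iff]
    filter_upwards [hne] with k hk
    have hk' : 0 < |k| := abs_pos.2 hk
    have s1 : ((|k| ^ (-(1 / 2) : ℝ) : ℝ) : ℂ) * ((|k| ^ (-(1 / 2) : ℝ) : ℝ) : ℂ)
        = ((|k|⁻¹ : ℝ) : ℂ) := by
      rw [← ofReal_mul, ← Real.rpow_add hk']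
      norm_num [Real.rpow_neg_one]
    have s2 : ((|k| ^ (1 / 2 : ℝ) : ℝ) : ℂ) * ((|k| ^ (1 / 2 : ℝ) : ℝ) : ℂ)
        = ((|k| : ℝ) : ℂ) := by
      rw [← ofReal_mul, ← Real.rpow_add hk']
      norm_num
    have s3 : ((|k| ^ (-(1 / 2) : ℝ) : ℝ) : ℂ) * ((|k| ^ (1 / 2 : ℝ) : ℝ) : ℂ) = 1 := by
      rw [← ofReal_mul, ← Real.rpow_add hk']
      norm_num
    have n1 := conj_mul' (ft (projPsi ψ p.1) k)
    have n2 := conj_mul' (ft p.2 k)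
    simp only [schubertAmplitude, map_add, map_mul, conj_ofReal, conj_I]
    push_cast at s1 s2 s3 ⊢
    rw [← n1, ← n2, ← s1, ← s2]
    generalize ft (projPsi ψ p.1) k = u at *
    generalize ft p.2 k = v at *
    linear_combination I * (conj u * v - conj v * u) * s3
      - ((|k| ^ (1 / 2 : ℝ) : ℝ) : ℂ) * ((|k| ^ (1 / 2 : ℝ) : ℝ) : ℂ) * (conj v * v) * I_mul_I
  -- With `F = ∫ p.1` and `G = ∫ ψ p.2`, the projection changes the antisymmetric part by a
  -- combination of `conj F * G` and `conj G * F`. The cross terms of the charge, where `r` meets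
  -- `1/r`, restore exactly this, so it agrees with the massive one.
  have e1 : ∫ x, conj (projPsi ψ p.1 x) * p.2 x = (∫ x, conj (p.1 x) * p.2 x)
      - conj (∫ x, p.1 x) * ∫ x, (ψ x : ℂ) * p.2 x := by
    rw [← integral_const_mul, ← integral_sub (h₁.integrable_conj_mul h₂)
      ((h₂.mul_left hψ.contDiff).integrable.const_mul _)]
    congr 1
    ext x
    simp only [projPsi, map_sub, map_mul, conj_ofReal]
    ring
  have e2 : ∫ x, conj (p.2 x) * projPsi ψ p.1 x = (∫ x, conj (p.2 x) * p.1 x)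
      - (∫ x, p.1 x) * conj (∫ x, (ψ x : ℂ) * p.2 x) := by
    rw [← integral_conj, ← integral_const_mul, ← integral_sub (h₂.integrable_conj_mul h₁)
      ((h₂.mul_left hψ.contDiff).conjugate.integrable.const_mul _)]
    congr 1
    ext x
    simp only [projPsi, map_mul, conj_ofReal]
    ring
  rw [schubertTwoPoint_eq hψ r h₁ h₂ h₁ h₂, eM, eA, e1, e2, integral_sub im is]
  simp only [schubertCharge, map_add, map_mul, map_div₀, conj_ofReal, conj_I]
  push_cast
  rw [← conj_mul' (∫ x, p.1 x), ← conj_mul' (∫ x, (ψ x : ℂ) * p.2 x)]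
  have hrc : (r : ℂ) ≠ 0 := ofReal_ne_zero.2 hr.ne'
  have hri : (r : ℂ) * (r : ℂ)⁻¹ = 1 := mul_inv_cancel₀ hrc
  generalize (∫ x, p.1 x) = F
  generalize (∫ x, (ψ x : ℂ) * p.2 x) = G
  simp only [div_eq_mul_inv]
  linear_combination (1 / 2 * I * (conj G * F - conj F * G)) * hri
    + (1 / 2 * ((r : ℂ)⁻¹) ^ 2 * (conj G * G)) * I_mul_I

end TwoPoint

/-! ### The trace-class estimate for the difference of the forms -/

section DiagonalEstimate

/-- Turns each bound of a functional on single vectors into one for whole families, whatever their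
size. -/
theorem IsBesselFamily.sum_sq_le {E : Type*} [SeminormedAddCommGroup E] [InnerProductSpace ℂ E]
    {ι : Type*} [Fintype ι] {f : ι → E} {T : ℝ} (hf : IsBesselFamily f T) (l : E →ₗ[ℂ] ℂ) {M : ℝ}
    (hM : 0 ≤ M) (hl : ∀ g, ‖l g‖ ^ 2 ≤ M * ‖g‖ ^ 2) : ∑ i, ‖l (f i)‖ ^ 2 ≤ T * M := by
  have := hf l (√M) fun g => le_of_sq_le_sq (by
    rw [mul_pow, Real.sq_sqrt hM]
    exact hl g) (by positivity)
  rwa [Real.sq_sqrt hM] at this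

namespace TestPair

variable {m : ℝ} {hm : 0 < m} {a b : ℝ}

/-- The Fourier transform of the first component at a point. -/
def ftFst (k : ℝ) : TestPair m hm a b →ₗ[ℂ] ℂ where
  toFun f := ft f.1 k
  map_add' f g := ft_add f.1 g.1 k
  map_smul' c f := ft_smul c f.1 k

/-- The Fourier transform of the second component at a point. -/
def ftSnd (k : ℝ) : TestPair m hm a b →ₗ[ℂ] ℂ where
  toFun f := ft f.2 k
  map_add' f g := ft_add f.2 g.2 k
  map_smul' c f := ft_smul c f.2 k

/-- The integral of the first component. -/
def integralFst : TestPair m hm a b →ₗ[ℂ] ℂ where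
  toFun f := ∫ x, f.1 x
  map_add' f g := integral_add (isTestFunction_coe f.1).integrable
    (isTestFunction_coe g.1).integrable
  map_smul' c _ := integral_const_mul c _

/-- The integral of the second component against a test function. -/
def integralSnd {ψ : ℝ → ℂ} (hψ : IsTestFunction ψ) : TestPair m hm a b →ₗ[ℂ] ℂ where
  toFun f := ∫ x, ψ x * f.2 x
  map_add' f g := by
    rw [← integral_add ((isTestFunction_coe f.2).mul_left hψ.contDiff).integrable
      ((isTestFunction_coe g.2).mul_left hψ.contDiff).integrable]
    simp only [← mul_add]
    rfl
  map_smul' c f := by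
    rw [RingHom.id_apply, smul_eq_mul, ← integral_const_mul]
    simp only [mul_left_comm c]
    rfl

theorem sq_norm_ftFst_le : ∃ C : ℝ, 0 ≤ C ∧ ∀ (f : TestPair m hm a b) (k : ℝ),
    ‖ftFst k f‖ ^ 2 ≤ C * (1 + |k|) * ‖f‖ ^ 2 := by
  obtain ⟨χ, hχ, hχ1⟩ := exists_cutoff a b
  obtain ⟨C, hC0, hC⟩ := sq_norm_ft_mul_fst_le (hm := hm) (a := a) (b := b) hχ
  refine ⟨C, hC0, fun f k => ?_⟩
  have := hC f k
  rwa [cutoff_mul hχ1] at this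

theorem sq_norm_ftSnd_le : ∃ C : ℝ, 0 ≤ C ∧ ∀ (f : TestPair m hm a b) (k : ℝ),
    ‖ftSnd k f‖ ^ 2 ≤ C * (1 + |k|)⁻¹ * ‖f‖ ^ 2 := by
  obtain ⟨χ, hχ, hχ1⟩ := exists_cutoff a b
  obtain ⟨C, hC0, hC⟩ := sq_norm_ft_mul_snd_le (hm := hm) (a := a) (b := b) hχ
  refine ⟨C, hC0, fun f k => ?_⟩
  have := hC f k
  rwa [cutoff_mul hχ1] at this

/-- Up to the factor `√(2π)` the integral is the evaluation at `k = 0`. -/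
theorem sq_norm_integralFst_le : ∃ C : ℝ, 0 ≤ C ∧ ∀ f : TestPair m hm a b,
    ‖integralFst f‖ ^ 2 ≤ C * ‖f‖ ^ 2 := by
  obtain ⟨C, hC0, hC⟩ := sq_norm_ftFst_le (hm := hm) (a := a) (b := b)
  refine ⟨2 * Real.pi * C, by positivity, fun f => ?_⟩
  have h1 := hC f 0
  have h2 : ‖ftFst 0 f‖ ^ 2 = (2 * Real.pi)⁻¹ * ‖integralFst f‖ ^ 2 := by
    change ‖ft f.1 0‖ ^ 2 = _
    rw [IsTestFunction.ft_zero, norm_mul, mul_pow, norm_real, Real.norm_eq_abs, sq_abs, inv_pow,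
      Real.sq_sqrt (by positivity)]
    rfl
  rw [h2, abs_zero, add_zero, mul_one, inv_mul_le_iff₀ (by positivity), ← mul_assoc] at h1
  exact h1

theorem sq_norm_integralSnd_le {ψ : ℝ → ℝ} (hψ : IsTestFunction fun x => (ψ x : ℂ)) :
    ∃ C : ℝ, 0 ≤ C ∧ ∀ f : TestPair m hm a b, ‖integralSnd hψ f‖ ^ 2 ≤ C * ‖f‖ ^ 2 := by
  obtain ⟨C, hC0, hC⟩ := sq_norm_integral_snd_le (hm := hm) (a := a) (b := b) hψ
  refine ⟨C, hC0, fun f => ?_⟩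
  have := hC f
  simp only [conj_ofReal] at this
  exact this

/-- The Fourier transform of `P_ψ` of the first component at a point. -/
def ftProj (ψ : ℝ → ℝ) (k : ℝ) : TestPair m hm a b →ₗ[ℂ] ℂ :=
  ftFst k - ft (fun x => (ψ x : ℂ)) k • integralFst

theorem ftProj_eq {ψ : ℝ → ℝ} (hψ : IsTestFunction fun x => (ψ x : ℂ)) (k : ℝ)
    (f : TestPair m hm a b) : ftProj ψ k f = ft (projPsi ψ f.1) k := by
  rw [ft_projPsi hψ (isTestFunction_coe f.1)]
  rfl

/-- Since `∫ ψ = 1`, the transform of `P_ψ f₁` vanishes at zero. Its derivative involves the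
transform of `-ix f₁`, which is an evaluation with the cutoff `-ixχ` and hence bounded by `‖f‖` on
`[-1, 1]`. The mean value inequality concludes. -/
theorem sq_norm_ftProj_le {ψ : ℝ → ℝ} (hψ : IsTestFunction fun x => (ψ x : ℂ))
    (hψ_int : ∫ x, ψ x = 1) : ∃ C : ℝ, 0 ≤ C ∧ ∀ (f : TestPair m hm a b) (k : ℝ), |k| ≤ 1 →
      ‖ftProj ψ k f‖ ^ 2 ≤ C * |k| ^ 2 * ‖f‖ ^ 2 := by
  have hu : ContDiff ℝ ∞ fun x : ℝ => -(I * (x : ℂ)) :=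
    (contDiff_const.mul Complex.ofRealCLM.contDiff).neg
  obtain ⟨χ, hχ, hχ1⟩ := exists_cutoff a b
  obtain ⟨C₁, hC₁0, hC₁⟩ := sq_norm_ft_mul_fst_le (hm := hm) (a := a) (b := b) (hχ.mul_left hu)
  obtain ⟨C₂, hC₂0, hC₂⟩ := sq_norm_integralFst_le (hm := hm) (a := a) (b := b)
  obtain ⟨C₃, hC₃0, hC₃⟩ := (hψ.mul_left hu).ft_decay
  set L := √(2 * C₁) + C₃ * √C₂
  refine ⟨L ^ 2, by positivity, fun f k hk => ?_⟩
  rw [← mul_pow, ← mul_pow]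
  gcongr
  have hder : ∀ x, HasDerivAt (fun k => ftProj ψ k f) (ft (fun y => -(I * y) * f.1 y) x
      - ft (fun y => -(I * y) * (ψ y : ℂ)) x * integralFst f) x := fun x =>
    ((isTestFunction_coe f.1).hasDerivAt_ft x).sub ((hψ.hasDerivAt_ft x).mul_const _)
  have hbound : ∀ x ∈ Set.Icc (-1 : ℝ) 1, ‖ft (fun y => -(I * y) * f.1 y) x
      - ft (fun y => -(I * y) * (ψ y : ℂ)) x * integralFst f‖ ≤ L * ‖f‖ := by
    intro x hx
    have h1 : ‖ft (fun y => -(I * y) * f.1 y) x‖ ≤ √(2 * C₁) * ‖f‖ := by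
      refine le_of_sq_le_sq ?_ (by positivity)
      have e : (fun y : ℝ => -(I * y) * f.1 y) = fun y => -(I * y) * χ y * f.1 y := by
        ext y
        have : χ y * f.1 y = f.1 y := congrFun (cutoff_mul hχ1 f.1) y
        rw [mul_assoc, this]
      rw [mul_pow, Real.sq_sqrt (by positivity), e]
      refine (hC₁ f x).trans ?_
      have : |x| ≤ 1 := abs_le.2 hx
      have : C₁ * (1 + |x|) ≤ C₁ * 2 := by gcongr; linarith
      rw [mul_comm 2]
      gcongr
    have h2 : ‖integralFst f‖ ≤ √C₂ * ‖f‖ := by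
      refine le_of_sq_le_sq ?_ (by positivity)
      rw [mul_pow, Real.sq_sqrt hC₂0]
      exact hC₂ f
    have h3 : ‖ft (fun y => -(I * y) * (ψ y : ℂ)) x‖ ≤ C₃ := (hC₃ x).trans
      (mul_le_of_le_one_right hC₃0 (inv_le_one_of_one_le₀
        (one_le_pow₀ (by linarith [abs_nonneg x]))))
    calc _ ≤ ‖ft (fun y => -(I * y) * f.1 y) x‖
          + ‖ft (fun y => -(I * y) * (ψ y : ℂ)) x‖ * ‖integralFst f‖ := by
          rw [← norm_mul]
          exact norm_sub_le _ _
      _ ≤ √(2 * C₁) * ‖f‖ + C₃ * (√C₂ * ‖f‖) := by gcongr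
      _ = L * ‖f‖ := by ring
  have := (convex_Icc (-1 : ℝ) 1).norm_image_sub_le_of_norm_hasDerivWithin_le
    (fun x _ => (hder x).hasDerivWithinAt) hbound (x := 0) (y := k) (by simp) (abs_le.1 hk)
  have h0 : ftProj ψ 0 f = 0 := by
    rw [ftProj_eq hψ, ft_projPsi_zero hψ hψ_int (isTestFunction_coe f.1)]
  rw [h0, sub_zero, sub_zero, Real.norm_eq_abs] at this
  linarith

end TestPair

/-- `ω - |k| = m² / (ω + |k|) ≤ m² / ω`. -/
theorem omega_sub_abs_le {m : ℝ} (hm : 0 < m) (k : ℝ) :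
    omega m k - |k| ≤ m ^ 2 * (1 + m⁻¹) * (1 + |k|)⁻¹ := by
  have h := omega_pos hm k
  have h1 : omega m k ^ 2 = |k| ^ 2 + m ^ 2 := by
    rw [sq_abs, omega, Real.sq_sqrt (by positivity)]
  have h2 : (omega m k - |k|) ≤ m ^ 2 * (omega m k)⁻¹ := by
    rw [← div_eq_mul_inv, le_div_iff₀ h]
    nlinarith [abs_nonneg k, abs_le_omega m k,
      mul_nonneg (abs_nonneg k) (sub_nonneg.2 (abs_le_omega m k))]
  rw [mul_assoc]
  exact h2.trans (mul_le_mul_of_nonneg_left (inv_omega_le hm k) (by positivity))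

theorem abs_sq_norm_sub_sq_norm_sub_le (u s F : ℂ) :
    |‖u‖ ^ 2 - ‖u - s * F‖ ^ 2| ≤ ‖s‖ * (‖u‖ ^ 2 + ‖F‖ ^ 2) + ‖s‖ ^ 2 * ‖F‖ ^ 2 := by
  have h1 : |‖u‖ - ‖u - s * F‖| ≤ ‖s‖ * ‖F‖ := by
    refine (abs_norm_sub_norm_le _ _).trans ?_
    rw [sub_sub_cancel, norm_mul]
  have h2 : ‖u - s * F‖ ≤ ‖u‖ + ‖s‖ * ‖F‖ := by
    rw [← norm_mul]
    exact norm_sub_le _ _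
  rw [sq_sub_sq, abs_mul, abs_of_nonneg (by positivity : 0 ≤ ‖u‖ + ‖u - s * F‖), mul_comm]
  calc |‖u‖ - ‖u - s * F‖| * (‖u‖ + ‖u - s * F‖)
      ≤ ‖s‖ * ‖F‖ * (‖u‖ + (‖u‖ + ‖s‖ * ‖F‖)) := by gcongr
    _ = ‖s‖ * (2 * ‖u‖ * ‖F‖) + ‖s‖ ^ 2 * ‖F‖ ^ 2 := by ring
    _ ≤ _ := by
      gcongr
      exact two_mul_le_add_sq _ _

namespace TestPair

variable {m : ℝ} {hm : 0 < m} {a b : ℝ}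

/-- No cancellation is needed: `ω⁻¹ ≤ m⁻¹`, and the quadratic bound on the projected evaluation
absorbs `|k|⁻¹`. The factor `4` comes from `(1 + |k|)² ≤ 4`. -/
theorem sum_abs_fst_low_le {ψ : ℝ → ℝ} (hψ : IsTestFunction fun x => (ψ x : ℂ))
    (hψ_int : ∫ x, ψ x = 1) : ∃ C : ℝ, 0 ≤ C ∧ ∀ {ι : Type} [Fintype ι]
      (f : ι → TestPair m hm a b) (T : ℝ), 0 ≤ T → IsBesselFamily f T → ∀ k : ℝ, |k| ≤ 1 →
      ∑ i, |(omega m k)⁻¹ * ‖ftFst k (f i)‖ ^ 2 - |k|⁻¹ * ‖ftProj ψ k (f i)‖ ^ 2|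
        ≤ C * T * ((1 + |k|) ^ 2)⁻¹ := by
  obtain ⟨C₁, hC₁0, hC₁⟩ := sq_norm_ftFst_le (hm := hm) (a := a) (b := b)
  obtain ⟨C₂, hC₂0, hC₂⟩ := sq_norm_ftProj_le (hm := hm) (a := a) (b := b) hψ hψ_int
  refine ⟨4 * (m⁻¹ * C₁ * 2 + C₂), by positivity, fun f T hT hf k hk => ?_⟩
  have hA := hf.sum_sq_le (ftFst k) (by positivity) fun g => hC₁ g k
  have hB := hf.sum_sq_le (ftProj ψ k) (by positivity) fun g => hC₂ g k hk
  have hω : (omega m k)⁻¹ ≤ m⁻¹ := inv_anti₀ hm (le_omega m k)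
  have hω0 : 0 ≤ (omega m k)⁻¹ := inv_nonneg.2 (omega_nonneg m k)
  have h4 : 1 ≤ 4 * ((1 + |k|) ^ 2)⁻¹ := by
    rw [← div_eq_mul_inv, le_div_iff₀ (by positivity)]
    nlinarith [abs_nonneg k]
  have hkk : |k|⁻¹ * |k| ^ 2 ≤ 1 := by
    rcases eq_or_ne |k| 0 with h | h
    · simp [h]
    · rw [sq, ← mul_assoc, inv_mul_cancel₀ h, one_mul]
      exact hk
  calc _ ≤ ∑ i, ((omega m k)⁻¹ * ‖ftFst k (f i)‖ ^ 2 + |k|⁻¹ * ‖ftProj ψ k (f i)‖ ^ 2) := by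
        refine Finset.sum_le_sum fun i _ => ?_
        refine (abs_sub _ _).trans (le_of_eq ?_)
        rw [abs_of_nonneg (by positivity), abs_of_nonneg (by positivity)]
    _ = (omega m k)⁻¹ * ∑ i, ‖ftFst k (f i)‖ ^ 2 + |k|⁻¹ * ∑ i, ‖ftProj ψ k (f i)‖ ^ 2 := by
        rw [Finset.sum_add_distrib, Finset.mul_sum, Finset.mul_sum]
    _ ≤ m⁻¹ * (T * (C₁ * (1 + 1))) + |k|⁻¹ * (T * (C₂ * |k| ^ 2)) := by
        gcongr
        refine hA.trans ?_
        gcongr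
    _ = m⁻¹ * (T * (C₁ * (1 + 1))) + T * C₂ * (|k|⁻¹ * |k| ^ 2) := by ring
    _ ≤ m⁻¹ * (T * (C₁ * (1 + 1))) + T * C₂ * 1 := by gcongr
    _ = (m⁻¹ * C₁ * 2 + C₂) * T * 1 := by ring
    _ ≤ (m⁻¹ * C₁ * 2 + C₂) * T * (4 * ((1 + |k|) ^ 2)⁻¹) := by gcongr
    _ = _ := by ring

/-- Cancellation is essential here: each term alone is only known to be bounded. The weights differ
by `O(|k|⁻³)` against evaluations of size `1 + |k|`, and replacing `f₁` by `P_ψ f₁` costs a factor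
`ft ψ`, which decays. -/
theorem sum_abs_fst_high_le {ψ : ℝ → ℝ} (hψ : IsTestFunction fun x => (ψ x : ℂ)) :
    ∃ C : ℝ, 0 ≤ C ∧ ∀ {ι : Type} [Fintype ι]
      (f : ι → TestPair m hm a b) (T : ℝ), 0 ≤ T → IsBesselFamily f T → ∀ k : ℝ, 1 ≤ |k| →
      ∑ i, |(omega m k)⁻¹ * ‖ftFst k (f i)‖ ^ 2 - |k|⁻¹ * ‖ftProj ψ k (f i)‖ ^ 2|
        ≤ C * T * ((1 + |k|) ^ 2)⁻¹ := by
  obtain ⟨C₁, hC₁0, hC₁⟩ := sq_norm_ftFst_le (hm := hm) (a := a) (b := b)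
  obtain ⟨C₂, hC₂0, hC₂⟩ := sq_norm_integralFst_le (hm := hm) (a := a) (b := b)
  obtain ⟨C₃, hC₃0, hC₃⟩ := hψ.ft_decay
  set c := m ^ 2 * (1 + m⁻¹)
  set d := 1 + m⁻¹
  have hc0 : 0 ≤ c := by positivity
  have hd0 : 0 ≤ d := by positivity
  refine ⟨c * 2 * d * C₁ + 2 * C₃ * C₁ + C₃ * C₂ + C₃ * C₃ * C₂, by positivity,
    fun f T hT hf k hk => ?_⟩
  have hA := hf.sum_sq_le (ftFst k) (by positivity) fun g => hC₁ g k
  have hF := hf.sum_sq_le integralFst hC₂0 hC₂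
  set A := ∑ i, ‖ftFst k (f i)‖ ^ 2
  set F := ∑ i, ‖integralFst (f i)‖ ^ 2
  have hA0 : 0 ≤ A := Finset.sum_nonneg fun i _ => by positivity
  have hF0 : 0 ≤ F := Finset.sum_nonneg fun i _ => by positivity
  set s := ft (fun x => (ψ x : ℂ)) k
  have hs : ‖s‖ ≤ C₃ * ((1 + |k|) ^ 2)⁻¹ := hC₃ k
  have hk0 : 0 < |k| := by linarith
  have hω0 := omega_pos hm k
  have hle := abs_le_omega m k
  have hp1 : (1 : ℝ) ≤ 1 + |k| := by linarith
  have hp : 0 < 1 + |k| := by linarith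
  have hq1 : ((1 + |k|) ^ 2)⁻¹ ≤ 1 := inv_le_one_of_one_le₀ (one_le_pow₀ hp1)
  have hs' : ‖s‖ ≤ C₃ := hs.trans (mul_le_of_le_one_right hC₃0 hq1)
  have hkinv : |k|⁻¹ ≤ 2 * (1 + |k|)⁻¹ := by
    rw [← div_eq_mul_inv, le_div_iff₀ hp, inv_mul_le_iff₀ hk0]
    linarith
  have hkinv1 : |k|⁻¹ ≤ 1 := inv_le_one_of_one_le₀ hk
  have hdiff0 : 0 ≤ |k|⁻¹ - (omega m k)⁻¹ := sub_nonneg.2 (inv_anti₀ hk0 hle)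
  have hdiff : |k|⁻¹ - (omega m k)⁻¹ ≤ c * 2 * d * ((1 + |k|)⁻¹) ^ 3 := by
    have e : |k|⁻¹ - (omega m k)⁻¹ = (omega m k - |k|) * |k|⁻¹ * (omega m k)⁻¹ := by
      field_simp
    rw [e]
    calc _ ≤ (c * (1 + |k|)⁻¹) * (2 * (1 + |k|)⁻¹) * (d * (1 + |k|)⁻¹) := by
          gcongr
          · exact omega_sub_abs_le hm k
          · exact inv_omega_le hm k
      _ = _ := by ring
  have e1 : ((1 + |k|)⁻¹) ^ 3 * (1 + |k|) = ((1 + |k|) ^ 2)⁻¹ := by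
    field_simp
  have e2 : (1 + |k|)⁻¹ * (1 + |k|) = 1 := inv_mul_cancel₀ hp.ne'
  calc _ ≤ ∑ i, ((|k|⁻¹ - (omega m k)⁻¹) * ‖ftFst k (f i)‖ ^ 2
          + |k|⁻¹ * (‖s‖ * (‖ftFst k (f i)‖ ^ 2 + ‖integralFst (f i)‖ ^ 2)
            + ‖s‖ ^ 2 * ‖integralFst (f i)‖ ^ 2)) := by
        refine Finset.sum_le_sum fun i _ => ?_
        have h1 := abs_sq_norm_sub_sq_norm_sub_le (ftFst k (f i)) s (integralFst (f i))
        have h2 : ftProj ψ k (f i) = ftFst k (f i) - s * integralFst (f i) := rfl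
        rw [h2, show (omega m k)⁻¹ * ‖ftFst k (f i)‖ ^ 2
            - |k|⁻¹ * ‖ftFst k (f i) - s * integralFst (f i)‖ ^ 2
          = -((|k|⁻¹ - (omega m k)⁻¹) * ‖ftFst k (f i)‖ ^ 2)
            + |k|⁻¹ * (‖ftFst k (f i)‖ ^ 2 - ‖ftFst k (f i) - s * integralFst (f i)‖ ^ 2) by ring]
        refine (abs_add_le _ _).trans ?_
        rw [abs_neg, abs_of_nonneg (mul_nonneg hdiff0 (by positivity)), abs_mul,
          abs_of_nonneg (inv_nonneg.2 (abs_nonneg k))]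
        gcongr
    _ = (|k|⁻¹ - (omega m k)⁻¹) * A + |k|⁻¹ * (‖s‖ * (A + F) + ‖s‖ ^ 2 * F) := by
        simp only [A, F, Finset.sum_add_distrib, Finset.mul_sum, mul_add]
    _ = (|k|⁻¹ - (omega m k)⁻¹) * A + |k|⁻¹ * ‖s‖ * A + |k|⁻¹ * ‖s‖ * F
          + |k|⁻¹ * (‖s‖ * ‖s‖) * F := by ring
    _ ≤ c * 2 * d * ((1 + |k|)⁻¹) ^ 3 * (T * (C₁ * (1 + |k|)))
          + 2 * (1 + |k|)⁻¹ * (C₃ * ((1 + |k|) ^ 2)⁻¹) * (T * (C₁ * (1 + |k|)))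
          + 1 * (C₃ * ((1 + |k|) ^ 2)⁻¹) * (T * C₂)
          + 1 * (C₃ * (C₃ * ((1 + |k|) ^ 2)⁻¹)) * (T * C₂) := by
        gcongr
    _ = _ := by
        linear_combination (c * 2 * d * T * C₁) * e1
          + (2 * C₃ * ((1 + |k|) ^ 2)⁻¹ * T * C₁) * e2

/-- The weight difference and the squared evaluation each contribute one factor `(1 + |k|)⁻¹`. -/
theorem sum_snd_le : ∃ C : ℝ, 0 ≤ C ∧ ∀ {ι : Type} [Fintype ι]
      (f : ι → TestPair m hm a b) (T : ℝ), 0 ≤ T → IsBesselFamily f T → ∀ k : ℝ,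
      ∑ i, (omega m k - |k|) * ‖ftSnd k (f i)‖ ^ 2 ≤ C * T * ((1 + |k|) ^ 2)⁻¹ := by
  obtain ⟨C₁, hC₁0, hC₁⟩ := sq_norm_ftSnd_le (hm := hm) (a := a) (b := b)
  refine ⟨m ^ 2 * (1 + m⁻¹) * C₁, by positivity, fun f T hT hf k => ?_⟩
  have hA := hf.sum_sq_le (ftSnd k) (by positivity) fun g => hC₁ g k
  rw [← Finset.mul_sum]
  calc _ ≤ m ^ 2 * (1 + m⁻¹) * (1 + |k|)⁻¹ * (T * (C₁ * (1 + |k|)⁻¹)) := by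
        gcongr
        exact omega_sub_abs_le hm k
    _ = _ := by
      rw [← inv_pow]
      ring

/-- The density in momentum space of the difference of the two-point functions. -/
def diagonalDensity (ψ : ℝ → ℝ) (f : TestPair m hm a b) (k : ℝ) : ℝ :=
  ((omega m k)⁻¹ * ‖ftFst k f‖ ^ 2 + omega m k * ‖ftSnd k f‖ ^ 2)
    - (|k|⁻¹ * ‖ftProj ψ k f‖ ^ 2 + |k| * ‖ftSnd k f‖ ^ 2)

theorem sum_abs_diagonalDensity_le {ψ : ℝ → ℝ} (hψ : IsTestFunction fun x => (ψ x : ℂ))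
    (hψ_int : ∫ x, ψ x = 1) : ∃ C : ℝ, 0 ≤ C ∧ ∀ {ι : Type} [Fintype ι]
      (f : ι → TestPair m hm a b) (T : ℝ), 0 ≤ T → IsBesselFamily f T → ∀ k : ℝ,
      ∑ i, |diagonalDensity ψ (f i) k| ≤ C * T * (1 + k ^ 2)⁻¹ := by
  obtain ⟨C₁, hC₁0, hC₁⟩ := sum_abs_fst_low_le (hm := hm) (a := a) (b := b) hψ hψ_int
  obtain ⟨C₂, hC₂0, hC₂⟩ := sum_abs_fst_high_le (hm := hm) (a := a) (b := b) hψ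
  obtain ⟨C₃, hC₃0, hC₃⟩ := sum_snd_le (hm := hm) (a := a) (b := b)
  refine ⟨C₁ + C₂ + C₃, by positivity, fun f T hT hf k => ?_⟩
  have h1 : ∑ i, |(omega m k)⁻¹ * ‖ftFst k (f i)‖ ^ 2 - |k|⁻¹ * ‖ftProj ψ k (f i)‖ ^ 2|
      ≤ (C₁ + C₂) * T * ((1 + |k|) ^ 2)⁻¹ := by
    rcases le_total |k| 1 with hk | hk
    · refine (hC₁ f T hT hf k hk).trans ?_
      gcongr
      linarith
    · refine (hC₂ f T hT hf k hk).trans ?_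
      gcongr
      linarith
  calc _ ≤ ∑ i, (|(omega m k)⁻¹ * ‖ftFst k (f i)‖ ^ 2 - |k|⁻¹ * ‖ftProj ψ k (f i)‖ ^ 2|
          + (omega m k - |k|) * ‖ftSnd k (f i)‖ ^ 2) := by
        refine Finset.sum_le_sum fun i _ => ?_
        rw [diagonalDensity, add_sub_add_comm, ← sub_mul]
        refine (abs_add_le _ _).trans ?_
        rw [abs_of_nonneg (a := (omega m k - |k|) * _)
          (mul_nonneg (sub_nonneg.2 (abs_le_omega m k)) (by positivity))]
    _ ≤ (C₁ + C₂) * T * ((1 + |k|) ^ 2)⁻¹ + C₃ * T * ((1 + |k|) ^ 2)⁻¹ := by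
        rw [Finset.sum_add_distrib]
        exact add_le_add h1 (hC₃ f T hT hf k)
    _ = (C₁ + C₂ + C₃) * T * ((1 + |k|) ^ 2)⁻¹ := by ring
    _ ≤ _ := by
        gcongr (C₁ + C₂ + C₃) * T * ?_
        exact one_add_abs_sq_inv_le k

theorem integrable_diagonalDensity {ψ : ℝ → ℝ} (hψ : IsTestFunction fun x => (ψ x : ℂ))
    (hψ_int : ∫ x, ψ x = 1) (f : TestPair m hm a b) : Integrable (diagonalDensity ψ f) := by
  have h₁ := isTestFunction_coe f.1
  have h₂ := isTestFunction_coe f.2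
  have hP := isTestFunction_projPsi hψ h₁
  have := ((integrable_omega_mul hm h₁).2.add (integrable_omega_mul hm h₂).1).sub
    ((hP.integrable_inv_abs_mul (ft_projPsi_zero hψ hψ_int h₁)).add h₂.integrable_abs_mul)
  refine this.congr (Filter.Eventually.of_forall fun k => ?_)
  simp only [diagonalDensity, ftProj_eq hψ]
  rfl

/-- The trace-class bound: the density estimate is integrated over `k`, and the two charge terms are
squares of bounded functionals. -/
theorem sum_norm_sub_le {ψ : ℝ → ℝ} (hψ : IsTestFunction fun x => (ψ x : ℂ))
    (hψ_int : ∫ x, ψ x = 1) {r : ℝ} (hr : 0 < r) :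
    ∃ C : ℝ, 0 ≤ C ∧ ∀ {ι : Type} [Fintype ι]
      (f : ι → TestPair m hm a b) (T : ℝ), 0 ≤ T → IsBesselFamily f T →
      ∑ i, ‖massiveTwoPoint m (f i).toFun (f i).toFun
        - schubertTwoPoint ψ r (f i).toFun (f i).toFun‖ ≤ C * T := by
  obtain ⟨C₁, hC₁0, hC₁⟩ := sum_abs_diagonalDensity_le (hm := hm) (a := a) (b := b) hψ hψ_int
  obtain ⟨C₂, hC₂0, hC₂⟩ := sq_norm_integralFst_le (hm := hm) (a := a) (b := b)
  obtain ⟨C₃, hC₃0, hC₃⟩ := sq_norm_integralSnd_le (hm := hm) (a := a) (b := b) hψ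
  have hπ : 0 ≤ ∫ k : ℝ, (1 + k ^ 2)⁻¹ := integral_nonneg fun k => by positivity
  refine ⟨1 / 2 * (C₁ * ∫ k : ℝ, (1 + k ^ 2)⁻¹) + 1 / 2 * r ^ 2 * C₂ + 1 / 2 * (r ^ 2)⁻¹ * C₃,
    by positivity, fun f T hT hf => ?_⟩
  have hF := hf.sum_sq_le integralFst hC₂0 hC₂
  have hG := hf.sum_sq_le (integralSnd hψ) hC₃0 hC₃
  have hi : ∀ i, Integrable fun k => |diagonalDensity ψ (f i) k| := fun i =>
    (integrable_diagonalDensity hψ hψ_int (f i)).abs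
  have hI : ∑ i, ∫ k, |diagonalDensity ψ (f i) k| ≤ C₁ * T * ∫ k : ℝ, (1 + k ^ 2)⁻¹ := by
    rw [← integral_finsetSum _ fun i _ => hi i, ← integral_const_mul]
    exact integral_mono (integrable_finsetSum _ fun i _ => hi i)
      (integrable_inv_one_add_sq.const_mul _) fun k => hC₁ f T hT hf k
  calc _ ≤ ∑ i, (1 / 2 * (∫ k, |diagonalDensity ψ (f i) k|)
          + 1 / 2 * r ^ 2 * ‖integralFst (f i)‖ ^ 2
          + 1 / 2 * (r ^ 2)⁻¹ * ‖integralSnd hψ (f i)‖ ^ 2) := by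
        refine Finset.sum_le_sum fun i _ => ?_
        have e : massiveTwoPoint m (f i).toFun (f i).toFun
            - schubertTwoPoint ψ r (f i).toFun (f i).toFun =
            ((1 / 2 * (∫ k, diagonalDensity ψ (f i) k)
              - 1 / 2 * r ^ 2 * ‖integralFst (f i)‖ ^ 2
              - 1 / 2 * (r ^ 2)⁻¹ * ‖integralSnd hψ (f i)‖ ^ 2 : ℝ) : ℂ) := by
          rw [massiveTwoPoint_sub_schubertTwoPoint hm hψ hψ_int hr
            (isTestFunction_coe (f i).1) (isTestFunction_coe (f i).2)]
          simp only [diagonalDensity, ftProj_eq hψ]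
          rfl
        rw [e, norm_real, Real.norm_eq_abs]
        have h1 : |∫ k, diagonalDensity ψ (f i) k| ≤ ∫ k, |diagonalDensity ψ (f i) k| :=
          abs_integral_le_integral_abs
        have h2 : 0 ≤ 1 / 2 * r ^ 2 * ‖integralFst (f i)‖ ^ 2 := by positivity
        have h3 : 0 ≤ 1 / 2 * (r ^ 2)⁻¹ * ‖integralSnd hψ (f i)‖ ^ 2 := by positivity
        rw [abs_le] at h1 ⊢
        constructor <;> linarith [h1.1, h1.2]
    _ = 1 / 2 * (∑ i, ∫ k, |diagonalDensity ψ (f i) k|)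
          + 1 / 2 * r ^ 2 * (∑ i, ‖integralFst (f i)‖ ^ 2)
          + 1 / 2 * (r ^ 2)⁻¹ * ∑ i, ‖integralSnd hψ (f i)‖ ^ 2 := by
        simp only [Finset.sum_add_distrib, Finset.mul_sum]
    _ ≤ 1 / 2 * (C₁ * T * ∫ k : ℝ, (1 + k ^ 2)⁻¹) + 1 / 2 * r ^ 2 * (T * C₂)
          + 1 / 2 * (r ^ 2)⁻¹ * (T * C₃) := by gcongr
    _ = _ := by ring

/-! ### The two forms -/

theorem isPositiveForm_massiveTwoPoint :
    IsPositiveForm fun f g : TestPair m hm a b => massiveTwoPoint m f.toFun g.toFun := by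
  have e : (fun f g : TestPair m hm a b => massiveTwoPoint m f.toFun g.toFun) = fun f g =>
      1 / 2 * ∫ k, conj (massiveAmplitude m f.toFun k) * massiveAmplitude m g.toFun k := by
    ext f g
    exact massiveTwoPoint_eq hm (isTestFunction_coe f.1) (isTestFunction_coe f.2)
      (isTestFunction_coe g.1) (isTestFunction_coe g.2)
  rw [e]
  refine isPositiveForm_integral (fun f g k => ?_) (fun c f k => ?_) fun f =>
    memLp_massiveAmplitude hm (isTestFunction_coe f.1) (isTestFunction_coe f.2)
  · change _ * ftFst k (f + g) + _ * ftSnd k (f + g) = (_ * ftFst k f + _ * ftSnd k f)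
      + (_ * ftFst k g + _ * ftSnd k g)
    rw [map_add, map_add]
    ring
  · change _ * ftFst k (c • f) + _ * ftSnd k (c • f) = c * (_ * ftFst k f + _ * ftSnd k f)
    rw [map_smul, map_smul, smul_eq_mul, smul_eq_mul]
    ring

theorem isPositiveForm_schubertTwoPoint {ψ : ℝ → ℝ} (hψ : IsTestFunction fun x => (ψ x : ℂ))
    (hψ_int : ∫ x, ψ x = 1) (r : ℝ) :
    IsPositiveForm fun f g : TestPair m hm a b => schubertTwoPoint ψ r f.toFun g.toFun := by
  let β : TestPair m hm a b →ₗ[ℂ] ℂ := (r : ℂ) • integralFst + (I / r) • integralSnd hψ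
  have e : (fun f g : TestPair m hm a b => schubertTwoPoint ψ r f.toFun g.toFun) = fun f g =>
      1 / 2 * (∫ k, conj (schubertAmplitude ψ f.toFun k) * schubertAmplitude ψ g.toFun k)
      + 1 / 2 * conj (β f) * β g := by
    ext f g
    exact schubertTwoPoint_eq hψ r (isTestFunction_coe f.1) (isTestFunction_coe f.2)
      (isTestFunction_coe g.1) (isTestFunction_coe g.2)
  have e' : ∀ (f : TestPair m hm a b) k, schubertAmplitude ψ f.toFun k =
      ((|k| ^ (-(1 / 2) : ℝ) : ℝ) : ℂ) * ftProj ψ k f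
        + I * ((|k| ^ (1 / 2 : ℝ) : ℝ) : ℂ) * ftSnd k f := fun f k => by
    rw [ftProj_eq hψ]
    rfl
  rw [e]
  refine (isPositiveForm_integral (fun f g k => ?_) (fun c f k => ?_) fun f =>
    memLp_schubertAmplitude hψ hψ_int (isTestFunction_coe f.1) (isTestFunction_coe f.2)).add
      (isPositiveForm_rankOne β)
  · rw [e', e', e', map_add, map_add]
    ring
  · rw [e', e', map_smul, map_smul, smul_eq_mul, smul_eq_mul]
    ring

/-- `‖f‖²` is the mean of the form at `f` and at its conjugate, and the latter value is nonnegative.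
-/
theorem re_massiveTwoPoint_le (f : TestPair m hm a b) :
    (massiveTwoPoint m f.toFun f.toFun).re ≤ 2 * ‖f‖ ^ 2 := by
  have h1 : 0 ≤ (massiveTwoPoint m (conjPair f.toFun) (conjPair f.toFun)).re := by
    have c₁ : IsTestFunction (conjPair f.toFun).1 := (isTestFunction_coe f.1).conjugate
    have c₂ : IsTestFunction (conjPair f.toFun).2 := (isTestFunction_coe f.2).conjugate
    rw [massiveTwoPoint_eq hm c₁ c₂ c₁ c₂]
    exact re_half_integral_conj_mul_self_nonneg _
  have h2 : ‖f‖ ^ 2 = (symmetrize (massiveTwoPoint m) f.toFun f.toFun).re := by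
    rw [← inner_self_eq_norm_sq (𝕜 := ℂ), inner_eq]
    rfl
  rw [h2, symmetrize, show (1 / 2 : ℂ) = ((1 / 2 : ℝ) : ℂ) by norm_num, re_ofReal_mul, add_re]
  linarith

/-- The trace estimate for a one-element family bounds the distance to the massive form by `C ‖f‖²`.
-/
theorem exists_re_schubertTwoPoint_le {ψ : ℝ → ℝ} (hψ : IsTestFunction fun x => (ψ x : ℂ))
    (hψ_int : ∫ x, ψ x = 1) {r : ℝ} (hr : 0 < r) :
    ∃ K : ℝ, ∀ f : TestPair m hm a b,
      (schubertTwoPoint ψ r f.toFun f.toFun).re ≤ K * ‖f‖ ^ 2 := by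
  obtain ⟨C, -, hC⟩ := sum_norm_sub_le (hm := hm) (a := a) (b := b) hψ hψ_int hr
  refine ⟨2 + C, fun f => ?_⟩
  have h1 := hC _ _ (by positivity) (isBesselFamily_single f)
  rw [Fintype.sum_unique] at h1
  have h2 := re_massiveTwoPoint_le f
  have h3 := (Complex.abs_re_le_norm _).trans h1
  rw [sub_re, abs_le] at h3
  linarith [h3.1]

end TestPair

end DiagonalEstimate

/-! ### The operators `Cm`, `Cs` and the conclusion -/

theorem existsUnique_defines {m : ℝ} {hm : 0 < m} {a b : ℝ}
    {W : (ℝ → ℂ) × (ℝ → ℂ) → (ℝ → ℂ) × (ℝ → ℂ) → ℂ}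
    (hW : IsPositiveForm fun f g : TestPair m hm a b => W f.toFun g.toFun) {K : ℝ}
    (hK : ∀ f : TestPair m hm a b, (W f.toFun f.toFun).re ≤ K * ‖f‖ ^ 2) :
    (∃! C : OneParticle m hm a b →L[ℂ] OneParticle m hm a b, Defines C W) ∧
      ∀ C : OneParticle m hm a b →L[ℂ] OneParticle m hm a b, Defines C W → 0 ≤ C := by
  obtain ⟨C, hC0, hC⟩ := exists_positive_operator hW hK
  have huniq : ∀ C' : OneParticle m hm a b →L[ℂ] OneParticle m hm a b, Defines C' W → C' = C :=
    fun C' hC' => operator_eq_of_inner_coe_eq fun f g => (hC' f g).symm.trans (hC f g)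
  exact ⟨⟨C, hC, huniq⟩, fun C' hC' => huniq C' hC' ▸ hC0⟩

end TimeZeroField

end

theorem mainTheorem4 (m : ℝ) (hm : 0 < m) (r : ℝ) (hr : 0 < r)
    (ψ : ℝ → ℝ) (hψ : ContDiff ℝ ∞ ψ) (hψ_supp : HasCompactSupport ψ) (hψ_int : ∫ x, ψ x = 1)
    (a b : ℝ) :
    (∃! C : TimeZeroField.OneParticle m hm a b →L[ℂ] TimeZeroField.OneParticle m hm a b,
      TimeZeroField.Defines C (TimeZeroField.massiveTwoPoint m)) ∧
    (∃! C : TimeZeroField.OneParticle m hm a b →L[ℂ] TimeZeroField.OneParticle m hm a b,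
      TimeZeroField.Defines C (TimeZeroField.schubertTwoPoint ψ r)) ∧
    ∀ Cm Cs : TimeZeroField.OneParticle m hm a b →L[ℂ] TimeZeroField.OneParticle m hm a b,
      TimeZeroField.Defines Cm (TimeZeroField.massiveTwoPoint m) →
      TimeZeroField.Defines Cs (TimeZeroField.schubertTwoPoint ψ r) →
      0 ≤ Cm ∧ 0 ≤ Cs ∧
        TimeZeroField.IsHilbertSchmidt (CFC.sqrt Cm - CFC.sqrt Cs) := by
  have hψt := TimeZeroField.isTestFunction_ofReal hψ hψ_supp
  obtain ⟨hm1, hm2⟩ := TimeZeroField.existsUnique_defines (hm := hm) (a := a) (b := b)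
    TimeZeroField.TestPair.isPositiveForm_massiveTwoPoint
    TimeZeroField.TestPair.re_massiveTwoPoint_le
  obtain ⟨K, hK⟩ := TimeZeroField.TestPair.exists_re_schubertTwoPoint_le (hm := hm) (a := a)
    (b := b) hψt hψ_int hr
  obtain ⟨hs1, hs2⟩ := TimeZeroField.existsUnique_defines
    (TimeZeroField.TestPair.isPositiveForm_schubertTwoPoint hψt hψ_int r) hK
  refine ⟨hm1, hs1, fun Cm Cs hCm hCs => ⟨hm2 Cm hCm, hs2 Cs hCs, ?_⟩⟩
  obtain ⟨C, -, hC⟩ := TimeZeroField.TestPair.sum_norm_sub_le (hm := hm) (a := a) (b := b)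
    hψt hψ_int hr
  -- The `4` is the Bessel factor of families in `L(I)` close to orthonormal ones.
  refine TimeZeroField.isHilbertSchmidt_sqrt_sub_sqrt (hm2 Cm hCm) (hs2 Cs hCs)
    (TimeZeroField.hasBoundedDiagonal_of_isBesselFamily (C := C * 4) fun s f hf => ?_)
  refine le_of_eq_of_le (Finset.sum_congr rfl fun i _ => ?_) (hC f 4 (by norm_num) hf)
  rw [_root_.sub_apply, inner_sub_right, ← hCm, ← hCs]
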